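/- For a lattice $N\subset\mathbb R^2$ with dual $M=\operatorname{Hom}(N,\mathbb Z)$ and a fan $\Delta$ of strict cones of $\mathbb R^2$ that are rational with respect to $N$, let $X(N,\Delta)$ be the complex toric surface glued from the charts $U_\sigma=\operatorname{Spec}\mathbb C[M\cap\check\sigma]$, $\sigma\in\Delta$; it contains the torus $T_N=\operatorname{Hom}(M,\mathbb C^*)$ as a dense open subset. The fan is \emph{regular} (with respect to $N$) if each of its cones is generated by part of a $\mathbb Z$-basis of $N$, i.e. if $X(N,\Delta)$ is smooth. A fan $\Delta'$ \emph{refines} $\Delta$ if both have the same support and every cone of $\Delta'$ is contained in a cone of $\Delta$. A linear map $\phi$ of $\mathbb R^2$ with $\phi(N)\subset N$ induces the monomial map $t\mapsto(m\mapsto t(m\circ\phi))$ of $T_N$, which extends to a meromorphic self-map $f$ of $X(N,\Delta)$; its graph is the closure of the graph of the monomial map. Let $I(f)$ be the indeterminacy set, i.e. the set of points over which the fibre of the graph is not a single point. The map $f$ is \emph{algebraically stable} if $\bigcup_{k\ge 0}f^{-k}(I(f))$, with total preimages taken through the graph, is a countable set of points. Let $e_1,e_2$ be the standard basis of $\mathbb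 R^2$, let $$\Delta=\{\{0\},\ \pm\mathbb R_+e_1,\ \pm\mathbb R_+e_2,\ \pm\mathbb R_+e_1\pm\mathbb R_+e_2\},$$ so that $X(\mathbb Z^2,\Delta)=\mathbb P^1\times\mathbb P^1$, and let $\phi(x)=Ax$ with $A=\begin{pmatrix}0&-8\\1&4\end{pmatrix}$, i.e. consider the monomial map $(z,w)\mapsto(w^{-8},zw^4)$. (i) There is no refinement $\Delta'$ of $\Delta$ that is a regular fan in the lattice $\mathbb Z^2$ and for which the map induced by $\phi$ on $X(\mathbb Z^2,\Delta')$ is algebraically stable. (Toric blow-ups of $\mathbb P^1\times\mathbb P^1$ do not suffice.) (ii) There are a sublattice $N'\subset\mathbb Z^2$ of finite index with $\phi(N')\subset N'$ and a refinement $\Delta'$ of $\Delta$ that is a regular fan in $N'$, such that the map induced by $\phi$ on $X(N',\Delta')$ is algebraically stable. (Passing to a ramified cover does suffice; by (i), necessarily $N'\ne\mathbb Z^2$.) -/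

import Mathlib

namespace Toric

/-- The real plane `N_ℝ`. -/
abbrev Plane : Type := Fin 2 → ℝ

/-- Convex cones with apex `0` in the plane. -/
abbrev Cone : Type := PointedCone ℝ Plane

/-- The standard lattice `ℤ²` in the plane. -/
def stdLattice : Submodule ℤ Plane :=
  Submodule.span ℤ (Set.range (Pi.basisFun ℝ (Fin 2)))

/-- A fan of cones in the plane, rational with respect to the lattice `N`. -/
structure Fan (N : Submodule ℤ Plane) where
  /-- the cones of the fan -/
  cones : Set Cone
  finite : cones.Finite
  zero_mem : ⊥ ∈ cones
  rational : ∀ σ ∈ cones, ∃ S : Finset Plane, (∀ v ∈ S, v ∈ N) ∧ σ = PointedCone.hull ℝ (S : Set Plane)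
  strict : ∀ σ ∈ cones, ∀ x ∈ σ, -x ∈ σ → x = 0
  face_mem : ∀ σ ∈ cones, ∀ τ : Cone, τ.IsFaceOf σ → τ ∈ cones
  inter_face : ∀ σ ∈ cones, ∀ τ ∈ cones, (σ ⊓ τ).IsFaceOf σ

namespace Fan

variable {N N' : Submodule ℤ Plane}

/-- The support of a fan: the union of its cones. -/
def support (Δ : Fan N) : Set Plane := {x | ∃ σ ∈ Δ.cones, x ∈ σ}

/-- `Δ'` is a refinement (subdivision) of `Δ`: both have the same support and every cone of `Δ'`
is contained in a cone of `Δ`. The lattices may differ. -/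
def Refines (Δ' : Fan N') (Δ : Fan N) : Prop :=
  Δ'.support = Δ.support ∧ ∀ σ' ∈ Δ'.cones, ∃ σ ∈ Δ.cones, σ' ≤ σ

/-- A fan is regular if each of its cones is generated by part of a `ℤ`-basis of the lattice `N`. -/
def IsRegular (Δ : Fan N) : Prop :=
  ∀ σ ∈ Δ.cones, ∃ (b : Module.Basis (Fin 2) ℤ N) (I : Set (Fin 2)),
    σ = PointedCone.hull ℝ ((fun i => (b i : Plane)) '' I)

end Fan

/-- The semigroup `S_σ` of all `m ∈ M = Hom (N, ℤ)` that are non-negative on `σ`, where `M` is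
seen as the set of real linear forms on the plane taking integer values on `N`. -/
def semigroup (N : Submodule ℤ Plane) (σ : Cone) : AddSubmonoid (Module.Dual ℝ Plane) where
  carrier := {m | (∀ n ∈ N, ∃ k : ℤ, m n = k) ∧ ∀ x ∈ σ, 0 ≤ m x}
  zero_mem' := ⟨fun _ _ => ⟨0, by simp⟩, fun _ _ => by simp⟩
  add_mem' := by
    rintro a b ⟨ha, ha'⟩ ⟨hb, hb'⟩
    refine ⟨fun n hn => ?_, fun x hx => ?_⟩
    · obtain ⟨k, hk⟩ := ha n hn
      obtain ⟨l, hl⟩ := hb n hn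
      exact ⟨k + l, by simp [hk, hl]⟩
    · simpa using add_nonneg (ha' x hx) (hb' x hx)

theorem semigroup_anti (N : Submodule ℤ Plane) {σ τ : Cone} (h : σ ≤ τ) :
    semigroup N τ ≤ semigroup N σ :=
  fun _ hm => ⟨hm.1, fun x hx => hm.2 x (h hx)⟩

/-- The complex points of the affine toric surface `U_σ = Spec ℂ[S_σ]`: the semigroup
homomorphisms `u : S_σ → ℂ` with `u 0 = 1`, `u (m + m') = u m * u m'`. -/
def Chart (N : Submodule ℤ Plane) (σ : Cone) : Type :=
  {u : semigroup N σ → ℂ // u 0 = 1 ∧ ∀ m m', u (m + m') = u m * u m'}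

/-- The classical topology of `U_σ`, which is the topology of pointwise convergence. -/
instance (N : Submodule ℤ Plane) (σ : Cone) : TopologicalSpace (Chart N σ) :=
  inferInstanceAs (TopologicalSpace
    {u : semigroup N σ → ℂ // u 0 = 1 ∧ ∀ m m', u (m + m') = u m * u m'})

/-- The torus `T_N = Hom (M, ℂˣ)`, that is the chart of the cone `{0}`. -/
abbrev Torus (N : Submodule ℤ Plane) : Type := Chart N ⊥

/-- For `σ ≤ τ` the map `U_σ → U_τ` given by restriction from `S_σ` to `S_τ`. -/
def Chart.map {N : Submodule ℤ Plane} {σ τ : Cone} (h : σ ≤ τ) (u : Chart N σ) : Chart N τ :=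
  ⟨fun m => u.1 ⟨m.1, semigroup_anti N h m.2⟩, u.2.1, fun m m' =>
    u.2.2 ⟨m.1, semigroup_anti N h m.2⟩ ⟨m'.1, semigroup_anti N h m'.2⟩⟩

namespace Fan

variable {N : Submodule ℤ Plane} (Δ : Fan N)

/-- Points of `U_σ` and `U_τ` are glued if they come from a common point of `U_(σ ∩ τ)`. -/
def Glued (p q : Σ σ : Δ.cones, Chart N σ.1) : Prop :=
  ∃ w : Chart N (p.1.1 ⊓ q.1.1), w.map inf_le_left = p.2 ∧ w.map inf_le_right = q.2

/-- The complex points of the toric surface `T_N emb (Δ)`: the union of the charts `U_σ`, `σ ∈ Δ`,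
glued along the charts `U_(σ ∩ τ)`. -/
def Surface : Type := Quot Δ.Glued

/-- The classical topology of the toric surface, obtained by gluing those of the charts. -/
instance : TopologicalSpace Δ.Surface :=
  inferInstanceAs (TopologicalSpace (Quot Δ.Glued))

/-- The embedding of the torus `T_N` in the toric surface as a dense open subset. -/
def torusEmb (t : Torus N) : Δ.Surface := Quot.mk _ ⟨⟨⊥, Δ.zero_mem⟩, t⟩

end Fan

/-- The monomial map `t ↦ (m ↦ t (m ∘ φ))` of the torus `T_N` induced by a linear map `φ` that
preserves the lattice `N`. For `N = ℤ²` and `φ` of matrix `!![a, b; c, d]` it is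
`(z, w) ↦ (z ^ a * w ^ b, z ^ c * w ^ d)` in the coordinates `z = t (e₁*)`, `w = t (e₂*)`. -/
def monomialMap {N : Submodule ℤ Plane} (φ : Plane →ₗ[ℝ] Plane) (hφ : ∀ n ∈ N, φ n ∈ N)
    (t : Torus N) : Torus N :=
  have key : ∀ m ∈ semigroup N ⊥, m ∘ₗ φ ∈ semigroup N ⊥ := fun m hm =>
    ⟨fun n hn => hm.1 (φ n) (hφ n hn), fun x hx => by
      rw [Submodule.mem_bot] at hx
      simp [hx]⟩
  ⟨fun m => t.1 ⟨m.1 ∘ₗ φ, key m.1 m.2⟩,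
    (congrArg t.1 (Subtype.ext (LinearMap.zero_comp φ))).trans t.2.1,
    fun m m' => (congrArg t.1 (Subtype.ext (LinearMap.add_comp φ m'.1 m.1))).trans
      (t.2.2 ⟨m.1 ∘ₗ φ, key m.1 m.2⟩ ⟨m'.1 ∘ₗ φ, key m'.1 m'.2⟩)⟩

namespace Fan

variable {N : Submodule ℤ Plane} (Δ : Fan N) (φ : Plane →ₗ[ℝ] Plane) (hφ : ∀ n ∈ N, φ n ∈ N)

/-- The graph in `X × X` of the meromorphic self-map `f` of the toric surface `X = T_N emb (Δ)`
induced by `φ`: the closure of the graph of the monomial map of the torus. -/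
def graph : Set (Δ.Surface × Δ.Surface) :=
  closure (Set.range fun t : Torus N => (Δ.torusEmb t, Δ.torusEmb (monomialMap φ hφ t)))

/-- The indeterminacy set `I(f)`: the points whose image `f(p)`, the fibre over `p` of the graph,
is not a single point. -/
def indeterminacy : Set Δ.Surface :=
  {p | ¬ ∃! q, (p, q) ∈ Δ.graph φ hφ}

/-- The total preimage `f⁻¹(E)` of a set `E`, taken through the graph of `f`. -/
def totalPreimage (E : Set Δ.Surface) : Set Δ.Surface :=
  {p | ∃ q ∈ E, (p, q) ∈ Δ.graph φ hφ}

/-- `f` is algebraically stable if the union over `k ≥ 0` of the sets `f⁻ᵏ(I(f))` is a countable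
set of points. -/
def AlgebraicallyStable : Prop :=
  (⋃ k : ℕ, (Δ.totalPreimage φ hφ)^[k] (Δ.indeterminacy φ hφ)).Countable

end Fan

/-- The cone generated by `s 0 • e₁` and `s 1 • e₂`, for signs `s 0`, `s 1` in `{-1, 0, 1}`. -/
def signCone (s : Fin 2 → SignType) : Cone :=
  PointedCone.hull ℝ (Set.range fun i => (Pi.single i (s i : ℝ) : Plane))

theorem single_mem_signCone (s : Fin 2 → SignType) (i : Fin 2) :
    (Pi.single i (s i : ℝ) : Plane) ∈ signCone s :=
  Submodule.subset_span ⟨i, rfl⟩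

theorem mem_signCone (s : Fin 2 → SignType) (x : Plane) :
    x ∈ signCone s ↔ ∀ i, ∃ c : ℝ, 0 ≤ c ∧ x i = c * (s i : ℝ) := by
  constructor
  · intro hx
    induction hx using Submodule.span_induction with
    | mem x h =>
      obtain ⟨j, rfl⟩ := h
      intro i
      by_cases h : i = j
      · subst h; exact ⟨1, zero_le_one, by simp⟩
      · exact ⟨0, le_rfl, by simp [Pi.single_eq_of_ne h]⟩
    | zero => exact fun i => ⟨0, le_rfl, by simp⟩
    | add x y _ _ hx hy =>
      intro i
      obtain ⟨c, hc, h⟩ := hx i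
      obtain ⟨d, hd, h'⟩ := hy i
      exact ⟨c + d, add_nonneg hc hd, by simp [h, h', add_mul]⟩
    | smul a x _ hx =>
      intro i
      obtain ⟨c, hc, h⟩ := hx i
      exact ⟨a.1 * c, mul_nonneg a.2 hc, by
        rw [mul_assoc, ← h]; rfl⟩
  · intro h
    choose c hc h using h
    have : x = ∑ i, c i • (Pi.single i (s i : ℝ) : Plane) := by
      ext j
      simp [Finset.sum_apply, Pi.single_apply, h j]
    rw [this]
    exact Submodule.sum_mem _ fun i _ =>
      PointedCone.smul_mem _ (hc i) (single_mem_signCone s i)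

theorem single_mem_stdLattice (i : Fin 2) (ε : SignType) :
    (Pi.single i (ε : ℝ) : Plane) ∈ stdLattice := by
  have h : (Pi.single i (1 : ℝ) : Plane) ∈ stdLattice :=
    Submodule.subset_span ⟨i, by simp⟩
  cases ε
  · simp
  · have := stdLattice.neg_mem h
    rw [← Pi.single_neg] at this
    simpa using this
  · simpa using h

theorem exists_signCone_of_face (s : Fin 2 → SignType) (τ : Cone) (h : τ.IsFaceOf (signCone s)) :
    ∃ t, signCone t = τ := by
  classical
  refine ⟨fun i => if (Pi.single i (s i : ℝ) : Plane) ∈ τ then s i else 0, le_antisymm ?_ ?_⟩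
  · refine Submodule.span_le.2 ?_
    rintro _ ⟨i, rfl⟩
    by_cases hi : (Pi.single i (s i : ℝ) : Plane) ∈ τ
    · simp [hi]
    · simp [hi]
  · intro x hx
    rw [mem_signCone]
    intro i
    obtain ⟨c, hc, hxi⟩ := (mem_signCone s x).1 (h.le hx) i
    rcases hc.eq_or_lt with rfl | hc'
    · exact ⟨0, le_rfl, by simpa using hxi⟩
    · have hmem : (Pi.single i (s i : ℝ) : Plane) ∈ τ := by
        refine h.mem_of_smul_add_mem (y := x - c • (Pi.single i (s i : ℝ) : Plane))
          (single_mem_signCone s i) ?_ hc' (by simpa using hx)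
        rw [mem_signCone]
        intro j
        by_cases hj : j = i
        · subst hj; exact ⟨0, le_rfl, by simp [hxi]⟩
        · simpa [Pi.single_eq_of_ne hj] using (mem_signCone s x).1 (h.le hx) j
      exact ⟨c, hc, by simpa [hmem] using hxi⟩

/-- The fan `{{0}, ±ℝ₊ e₁, ±ℝ₊ e₂, ±ℝ₊ e₁ ± ℝ₊ e₂}` in the lattice `ℤ²`, whose toric surface is
`ℙ¹ × ℙ¹`. -/
def fanP1xP1 : Fan stdLattice where
  cones := Set.range signCone
  finite := Set.finite_range _
  zero_mem := ⟨0, by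
    rw [signCone, PointedCone.hull, Submodule.span_eq_bot]
    rintro _ ⟨i, rfl⟩
    simp⟩
  rational := by
    classical
    rintro _ ⟨s, rfl⟩
    refine ⟨Finset.univ.image fun i => (Pi.single i (s i : ℝ) : Plane), ?_, ?_⟩
    · intro v hv
      obtain ⟨i, -, rfl⟩ := Finset.mem_image.1 hv
      exact single_mem_stdLattice i (s i)
    · simp [signCone]
  strict := by
    rintro _ ⟨s, rfl⟩ x hx hx'
    ext i
    obtain ⟨c, hc, h⟩ := (mem_signCone s x).1 hx i
    obtain ⟨d, hd, h'⟩ := (mem_signCone s (-x)).1 hx' i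
    rw [Pi.neg_apply] at h'
    rcases hs : s i with _ | _ | _ <;> simp [hs] at h h' ⊢ <;> linarith
  face_mem := by
    rintro _ ⟨s, rfl⟩ τ h
    exact exists_signCone_of_face s τ h
  inter_face := by
    rintro _ ⟨s, rfl⟩ _ ⟨t, rfl⟩
    refine ⟨inf_le_left, ?_⟩
    intro x y a hx hy ha hxy
    refine ⟨hx, (mem_signCone t x).2 fun i => ?_⟩
    obtain ⟨c, hc, h⟩ := (mem_signCone s x).1 hx i
    obtain ⟨d, hd, h'⟩ := (mem_signCone s y).1 hy i
    obtain ⟨e, he, h''⟩ := (mem_signCone t _).1 hxy.2 i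
    simp only [Pi.add_apply, Pi.smul_apply, smul_eq_mul, h, h'] at h''
    rcases hc.eq_or_lt with rfl | hc'
    · exact ⟨0, le_rfl, by simpa using h⟩
    · have hac : 0 < a * c := mul_pos ha hc'
      rcases hs : s i with _ | _ | _ <;> rcases ht : t i with _ | _ | _ <;>
        first
        | exact ⟨0, le_rfl, by simpa [hs] using h⟩
        | exact ⟨c, hc, by simpa [hs] using h⟩
        | (exfalso
           simp [hs, ht] at h''
           linarith)

/-- The real linear map `x ↦ A x` given by an integer matrix `A`, acting on column vectors. -/
noncomputable def matrixMap (A : Matrix (Fin 2) (Fin 2) ℤ) : Plane →ₗ[ℝ] Plane :=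
  Matrix.toLin' (A.map (Int.cast : ℤ → ℝ))

theorem matrixMap_mem_stdLattice (A : Matrix (Fin 2) (Fin 2) ℤ) :
    ∀ n ∈ stdLattice, matrixMap A n ∈ stdLattice := by
  have key : ∀ x : Plane, x ∈ stdLattice ↔ ∀ i, ∃ k : ℤ, (k : ℝ) = x i := by
    intro x
    rw [stdLattice, Module.Basis.mem_span_iff_repr_mem]
    simp
  intro n hn
  rw [key] at hn ⊢
  choose k hk using hn
  intro i
  refine ⟨∑ j, A i j * k j, ?_⟩
  simp [matrixMap, Matrix.toLin'_apply, Matrix.mulVec, dotProduct, hk]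

end Toric

/-! The eigenvalues of `A` are `2 ± 2i`, so up to scaling `A` is conjugate to a rotation by 45
degrees and `A ^ 8 = 4096`. Every ray therefore returns to itself under `φ ^ 8`.

(i) Let a regular refinement in `ℤ²` be algebraically stable. If `φ` moved a ray into the interior
of a two-dimensional cone, the curve of that ray would be contracted to a torus-fixed point. Since
the orbit meets a ray again later, that fixed point is carried to a point of indeterminacy, and
uncountably many points of the curve would lie in a preimage of `I(f)`. So `φ` maps rays to rays
(`AlgebraicallyStable.rayPt_map`), and by periodicity only rays go to rays. Hence `φ` takes the
generators `b₀, b₁` of a two-dimensional cone to `x b₀', y b₁'` for a lattice basis `b₀', b₁'`, with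
`x y = det A = 8` (`exists_basis_map_vec`). Thus `{x, y}` is `{1, 8}` or `{2, 4}`, and a congruence
modulo 8 (`OddType`) tells which of the two sets the factor of a primitive vector belongs to. The
two generators of a cone must agree, but `e₁` and `e₂`, which are rays of every refinement, do not.
A lattice basis of rays with different types cannot span a cone, so its sum is again a ray
(`rayPt_add_of_mixed`), and the sum differs in type from one of the two. This Farey-type subdivision
never stops (`exists_large_mixed_basis`), whereas a fan is finite.

(ii) The lines through `e₁, e₂, (-2, 1), (-4, 1)` are permuted by `φ`. In `2ℤ × ℤ` adjacent
primitive generators of these lines form bases, which fails in `ℤ²`. The fan they cut out is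
regular, `φ` maps its cones into cones, and `I(f)` is empty. To see that the image of a point is
unique, the linear forms defining the four lines are read as continuous maps to the Riemann sphere.
They separate the points of the surface (`wallFan_ext`), and `φ` pulls each back to a multiple of
another, so for `(p, q)` in the graph `p` determines `q`. -/

namespace Toric

/-! ### Lattice bases and the simplicial cones they span. -/

/-- A `ℤ`-basis of the lattice `N` that is also a basis of the plane, with its dual basis. -/
structure LatticeBasis (N : Submodule ℤ Plane) where
  /-- the basis vectors -/
  vec : Fin 2 → Plane
  /-- the coordinate forms -/
  coord : Fin 2 → Module.Dual ℝ Plane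
  vec_mem : ∀ i, vec i ∈ N
  coord_int : ∀ i, ∀ n ∈ N, ∃ k : ℤ, coord i n = k
  coord_vec : ∀ i j, coord i (vec j) = if i = j then 1 else 0
  sum_coord : ∀ x, coord 0 x • vec 0 + coord 1 x • vec 1 = x

namespace LatticeBasis

variable {N : Submodule ℤ Plane} (B : LatticeBasis N)

theorem vec_ne_zero (i : Fin 2) : B.vec i ≠ 0 := fun h => by
  simpa [h] using B.coord_vec i i

theorem sum_coord' (x : Plane) : ∑ i, B.coord i x • B.vec i = x := by
  rw [Fin.sum_univ_two, B.sum_coord]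

theorem ext_coord {x y : Plane} (h : ∀ i, B.coord i x = B.coord i y) : x = y := by
  rw [← B.sum_coord x, ← B.sum_coord y, h, h]

theorem apply_eq (m : Module.Dual ℝ Plane) (x : Plane) :
    m x = B.coord 0 x * m (B.vec 0) + B.coord 1 x * m (B.vec 1) := by
  conv_lhs => rw [← B.sum_coord x]
  simp

theorem form_ext {m m' : Module.Dual ℝ Plane} (h : ∀ i, m (B.vec i) = m' (B.vec i)) : m = m' :=
  LinearMap.ext fun x => by rw [B.apply_eq m, B.apply_eq m', h, h]

theorem vec_mem_hull {I : Set (Fin 2)} {i : Fin 2} (hi : i ∈ I) :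
    B.vec i ∈ PointedCone.hull ℝ (B.vec '' I) :=
  Submodule.subset_span ⟨i, hi, rfl⟩

theorem mem_hull_iff (I : Set (Fin 2)) (x : Plane) :
    x ∈ PointedCone.hull ℝ (B.vec '' I) ↔ ∀ i, 0 ≤ B.coord i x ∧ (i ∉ I → B.coord i x = 0) := by
  constructor
  · intro hx i
    induction hx using Submodule.span_induction with
    | mem x h =>
      obtain ⟨j, hj, rfl⟩ := h
      rw [B.coord_vec]
      split_ifs with h
      · exact ⟨zero_le_one, fun h' => absurd (h ▸ hj) h'⟩
      · simp
    | zero => simp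
    | add x y _ _ hx hy =>
      rw [map_add]
      exact ⟨add_nonneg hx.1 hy.1, fun h => by rw [hx.2 h, hy.2 h, add_zero]⟩
    | smul a x _ hx =>
      have : B.coord i (a • x) = a.1 * B.coord i x := (B.coord i).map_smul a.1 x
      rw [this]
      exact ⟨mul_nonneg a.2 hx.1, fun h => by rw [hx.2 h, mul_zero]⟩
  · intro h
    rw [← B.sum_coord' x]
    refine Submodule.sum_mem _ fun i _ => ?_
    by_cases hi : i ∈ I
    · exact PointedCone.smul_mem _ (h i).1 (B.vec_mem_hull hi)
    · rw [(h i).2 hi, zero_smul]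
      exact zero_mem _

theorem mem_hull_range_iff (x : Plane) :
    x ∈ PointedCone.hull ℝ (Set.range B.vec) ↔ ∀ i, 0 ≤ B.coord i x := by
  rw [← Set.image_univ, mem_hull_iff]
  simp

theorem isFaceOf_hull {I J : Set (Fin 2)} (h : J ⊆ I) :
    (PointedCone.hull ℝ (B.vec '' J)).IsFaceOf (PointedCone.hull ℝ (B.vec '' I)) := by
  refine ⟨Submodule.span_mono (Set.image_mono h), ?_⟩
  intro x y a hx hy ha hxy
  rw [mem_hull_iff] at hx hy hxy ⊢
  refine fun i => ⟨(hx i).1, fun hi => ?_⟩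
  have := (hxy i).2 hi
  rw [map_add, map_smul, smul_eq_mul] at this
  have h1 := (hx i).1
  have h2 := (hy i).1
  have h3 : a * B.coord i x = 0 := le_antisymm (by linarith) (by positivity)
  exact (mul_eq_zero.1 h3).resolve_left ha.ne'

/-- Splitting off the term `B.coord i x • B.vec i` leaves a point of the cone, and a face containing
a sum contains its summands. -/
theorem mem_face_of_coord_pos {I : Set (Fin 2)} {τ : Cone}
    (h : τ.IsFaceOf (PointedCone.hull ℝ (B.vec '' I))) {x : Plane} (hx : x ∈ τ) {i : Fin 2}
    (hi : 0 < B.coord i x) : B.vec i ∈ τ := by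
  have hx' := (B.mem_hull_iff I x).1 (h.le hx)
  have hiI : i ∈ I := by
    by_contra h'
    exact hi.ne' ((hx' i).2 h')
  refine h.mem_of_smul_add_mem (y := x - B.coord i x • B.vec i) (B.vec_mem_hull hiI) ?_ hi
    (by simpa using hx)
  rw [mem_hull_iff]
  intro j
  rw [map_sub, map_smul, B.coord_vec, smul_eq_mul]
  by_cases hj : j = i
  · subst hj; simp [hiI]
  · simpa [hj] using hx' j

theorem face_eq {I : Set (Fin 2)} {τ : Cone}
    (h : τ.IsFaceOf (PointedCone.hull ℝ (B.vec '' I))) :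
    τ = PointedCone.hull ℝ (B.vec '' {i | i ∈ I ∧ B.vec i ∈ τ}) := by
  refine le_antisymm (fun x hx => ?_) (Submodule.span_le.2 ?_)
  · rw [mem_hull_iff]
    intro i
    have hx' := (B.mem_hull_iff I x).1 (h.le hx) i
    refine ⟨hx'.1, fun hi => ?_⟩
    by_contra h0
    refine hi ⟨?_, B.mem_face_of_coord_pos h hx (lt_of_le_of_ne hx'.1 (Ne.symm h0))⟩
    by_contra h1
    exact h0 (hx'.2 h1)
  · rintro _ ⟨i, hi, rfl⟩
    exact hi.2

/-- The basis with the two vectors exchanged. -/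
def swap : LatticeBasis N where
  vec i := B.vec (1 - i)
  coord i := B.coord (1 - i)
  vec_mem i := B.vec_mem _
  coord_int i := B.coord_int _
  coord_vec i j := by rw [B.coord_vec]; simp
  sum_coord x := by simpa [add_comm] using B.sum_coord x

theorem range_swap_vec : Set.range B.swap.vec = Set.range B.vec := by
  ext x
  simp [swap, Fin.exists_fin_two, or_comm]

/-- The basis `(b₀, b₀ + b₁)`. -/
def addRight : LatticeBasis N where
  vec := ![B.vec 0, B.vec 0 + B.vec 1]
  coord := ![B.coord 0 - B.coord 1, B.coord 1]
  vec_mem := by simp [Fin.forall_fin_two, B.vec_mem, add_mem]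
  coord_int := by
    rw [Fin.forall_fin_two]
    refine ⟨fun n hn => ?_, B.coord_int 1⟩
    obtain ⟨k, hk⟩ := B.coord_int 0 n hn
    obtain ⟨l, hl⟩ := B.coord_int 1 n hn
    exact ⟨k - l, by simp [hk, hl]⟩
  coord_vec := by simp [Fin.forall_fin_two, B.coord_vec]
  sum_coord x := by
    conv_rhs => rw [← B.sum_coord x]
    simp only [Matrix.cons_val_zero, Matrix.cons_val_one, LinearMap.sub_apply]
    module

/-- The basis `(b₀ + b₁, b₁)`. -/
def addLeft : LatticeBasis N where
  vec := ![B.vec 0 + B.vec 1, B.vec 1]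
  coord := ![B.coord 0, B.coord 1 - B.coord 0]
  vec_mem := by simp [Fin.forall_fin_two, B.vec_mem, add_mem]
  coord_int := by
    rw [Fin.forall_fin_two]
    refine ⟨B.coord_int 0, fun n hn => ?_⟩
    obtain ⟨k, hk⟩ := B.coord_int 0 n hn
    obtain ⟨l, hl⟩ := B.coord_int 1 n hn
    exact ⟨l - k, by simp [hk, hl]⟩
  coord_vec := by simp [Fin.forall_fin_two, B.coord_vec]
  sum_coord x := by
    conv_rhs => rw [← B.sum_coord x]
    simp only [Matrix.cons_val_zero, Matrix.cons_val_one, LinearMap.sub_apply]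
    module

theorem exists_basis : ∃ b : Module.Basis (Fin 2) ℤ N, ∀ i, (b i : Plane) = B.vec i := by
  have hli : LinearIndependent ℤ (fun i => (⟨B.vec i, B.vec_mem i⟩ : N)) := by
    rw [Fintype.linearIndependent_iff]
    intro g hg i
    have h : ∑ j, g j • B.vec j = 0 := by
      simpa only [N.coe_sum, Submodule.coe_smul, Submodule.coe_zero] using congrArg Subtype.val hg
    have h' := congrArg (B.coord i) h
    simpa only [← Int.cast_smul_eq_zsmul ℝ, map_sum, map_smul, B.coord_vec, smul_ite, smul_zero,
      smul_eq_mul, mul_ite, mul_zero, mul_one, Finset.sum_ite_eq, Finset.mem_univ, if_true, map_zero,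
      Int.cast_eq_zero] using h'
  refine ⟨Module.Basis.mk hli ?_, fun i => by rw [Module.Basis.mk_apply]⟩
  rintro ⟨n, hn⟩ -
  choose k hk using fun i => B.coord_int i n hn
  have : (⟨n, hn⟩ : N) = ∑ i, k i • (⟨B.vec i, B.vec_mem i⟩ : N) := by
    apply Subtype.ext
    refine (B.sum_coord' n).symm.trans ?_
    simp only [hk, Int.cast_smul_eq_zsmul, N.coe_sum, Submodule.coe_smul]
  rw [this]
  exact Submodule.sum_mem _ fun i _ => Submodule.smul_mem _ _ (Submodule.subset_span ⟨i, rfl⟩)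

end LatticeBasis

/-- A `ℤ`-basis of a full lattice is an `ℝ`-basis of the plane, which supplies the coordinate forms.
This is how regularity enters part (i). -/
theorem exists_latticeBasis_stdLattice (b : Module.Basis (Fin 2) ℤ stdLattice) :
    ∃ B : LatticeBasis stdLattice, ∀ i, B.vec i = b i := by
  have : DiscreteTopology stdLattice := by unfold stdLattice; infer_instance
  have : IsZLattice ℝ stdLattice := by unfold stdLattice; infer_instance
  let c := b.ofZLatticeBasis ℝ stdLattice
  have hc : ∀ i, c i = b i := fun i => b.ofZLatticeBasis_apply ℝ stdLattice i
  refine ⟨⟨fun i => b i, c.coord, fun i => (b i).2, fun i n hn => ?_, fun i j => ?_, fun x => ?_⟩,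
    fun i => rfl⟩
  · exact ⟨b.repr ⟨n, hn⟩ i, b.ofZLatticeBasis_repr_apply ℝ stdLattice ⟨n, hn⟩ i⟩
  · rw [← hc, Module.Basis.coord_apply, Module.Basis.repr_self, Finsupp.single_apply]
    simp [eq_comm]
  · simpa [hc] using c.sum_repr x

end Toric

/-! ### Limits of one-parameter subgroups in the charts. -/

namespace Toric

open Filter Topology

variable {N : Submodule ℤ Plane}

/-- Powers `z ^ m(v)` need an integer exponent. The floor serves as that integer, and nothing is
lost because `m` is integral on `N`. -/
theorem floor_cast {σ : Cone} {m : Module.Dual ℝ Plane} (hm : m ∈ semigroup N σ) {v : Plane}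
    (hv : v ∈ N) : ((⌊m v⌋ : ℤ) : ℝ) = m v := by
  obtain ⟨k, hk⟩ := hm.1 v hv
  rw [hk, Int.floor_intCast]

theorem floor_add {σ : Cone} {m m' : Module.Dual ℝ Plane} (hm : m ∈ semigroup N σ) {v : Plane}
    (hv : v ∈ N) : ⌊(m + m') v⌋ = ⌊m v⌋ + ⌊m' v⌋ := by
  rw [LinearMap.add_apply, ← floor_cast hm hv, Int.floor_intCast_add, Int.floor_intCast]

theorem mem_semigroup_bot {m : Module.Dual ℝ Plane} (hm : ∀ n ∈ N, ∃ k : ℤ, m n = k) :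
    m ∈ semigroup N ⊥ :=
  ⟨hm, fun x hx => by rw [(Submodule.mem_bot _).1 hx, map_zero]⟩

theorem neg_integral {m : Module.Dual ℝ Plane} (hm : ∀ n ∈ N, ∃ k : ℤ, m n = k) :
    ∀ n ∈ N, ∃ k : ℤ, (-m) n = k := fun n hn => by
  obtain ⟨k, hk⟩ := hm n hn
  exact ⟨-k, by simp [hk]⟩

namespace Chart

theorem apply_add {σ : Cone} (u : Chart N σ) {a b c : Module.Dual ℝ Plane}
    (ha : a ∈ semigroup N σ) (hb : b ∈ semigroup N σ) (hc : c ∈ semigroup N σ) (h : c = a + b) :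
    u.1 ⟨c, hc⟩ = u.1 ⟨a, ha⟩ * u.1 ⟨b, hb⟩ := by
  subst h
  exact u.2.2 ⟨a, ha⟩ ⟨b, hb⟩

theorem apply_zero {σ : Cone} (u : Chart N σ) {a : Module.Dual ℝ Plane}
    (ha : a ∈ semigroup N σ) (h : a = 0) : u.1 ⟨a, ha⟩ = 1 := by
  subst h
  exact u.2.1

theorem mul_neg_apply {σ : Cone} (u : Chart N σ) {m : Module.Dual ℝ Plane}
    (hm : m ∈ semigroup N σ) (hm' : -m ∈ semigroup N σ) : u.1 ⟨m, hm⟩ * u.1 ⟨-m, hm'⟩ = 1 := by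
  rw [← u.apply_add hm hm' (zero_mem _) (by simp), u.apply_zero _ rfl]

theorem apply_ne_zero {σ : Cone} (u : Chart N σ) {m : Module.Dual ℝ Plane}
    (hm : m ∈ semigroup N σ) (hm' : -m ∈ semigroup N σ) : u.1 ⟨m, hm⟩ ≠ 0 :=
  left_ne_zero_of_mul_eq_one (u.mul_neg_apply hm hm')

theorem torus_apply_ne_zero (t : Torus N) (m : semigroup N ⊥) : t.1 m ≠ 0 :=
  t.apply_ne_zero m.2 (mem_semigroup_bot (neg_integral m.2.1))

theorem continuous_apply {σ : Cone} (m : semigroup N σ) :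
    Continuous fun u : Chart N σ => u.1 m :=
  (_root_.continuous_apply m).comp (continuous_subtype_val (p := fun u : semigroup N σ → ℂ =>
    u 0 = 1 ∧ ∀ m m', u (m + m') = u m * u m'))

theorem tendsto_iff {σ : Cone} {ι : Type*} {l : Filter ι} {f : ι → Chart N σ} {u : Chart N σ} :
    Tendsto f l (𝓝 u) ↔ ∀ m, Tendsto (fun i => (f i).1 m) l (𝓝 (u.1 m)) := by
  rw [← tendsto_pi_nhds]
  exact (Topology.IsInducing.subtypeVal (t := fun u : semigroup N σ → ℂ =>
    u 0 = 1 ∧ ∀ m m', u (m + m') = u m * u m')).tendsto_nhds_iff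

/-- The limit of `λ_v(s) t` for `s → 0`, where `λ_v` is the one-parameter subgroup given by a
point `v` of the cone `σ`. -/
noncomputable def limitPoint (σ : Cone) {v : Plane} (hv : v ∈ σ) (t : Torus N) : Chart N σ :=
  open Classical in
  ⟨fun m => if m.1 v = 0 then t.1 ⟨m.1, semigroup_anti N bot_le m.2⟩ else 0, by
    exact (if_pos (by simp)).trans t.2.1, by
    rintro ⟨m, hm⟩ ⟨m', hm'⟩
    have h1 := hm.2 v hv
    have h2 := hm'.2 v hv
    have h3 : (m + m') v = 0 ↔ m v = 0 ∧ m' v = 0 := by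
      rw [LinearMap.add_apply]
      exact add_eq_zero_iff_of_nonneg h1 h2
    change (if (m + m') v = 0 then _ else _) = _
    by_cases h4 : m v = 0 <;> by_cases h5 : m' v = 0 <;> simp only [h3, h4, h5] <;> simp
    exact t.2.2 ⟨m, _⟩ ⟨m', _⟩⟩

theorem limitPoint_of_eq_zero {σ : Cone} {v : Plane} (hv : v ∈ σ) (t : Torus N)
    {m : Module.Dual ℝ Plane} (hm : m ∈ semigroup N σ) (h : m v = 0) :
    (limitPoint σ hv t).1 ⟨m, hm⟩ = t.1 ⟨m, semigroup_anti N bot_le hm⟩ :=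
  if_pos h

theorem limitPoint_of_ne_zero {σ : Cone} {v : Plane} (hv : v ∈ σ) (t : Torus N)
    {m : Module.Dual ℝ Plane} (hm : m ∈ semigroup N σ) (h : m v ≠ 0) :
    (limitPoint σ hv t).1 ⟨m, hm⟩ = 0 :=
  if_neg h

theorem map_limitPoint {σ τ : Cone} (h : σ ≤ τ) {v : Plane} (hv : v ∈ σ) (t : Torus N) :
    (limitPoint σ hv t).map h = limitPoint τ (h hv) t :=
  rfl

/-- The translate of a point of the torus by the point `z` of the one-parameter subgroup of `v`. -/
noncomputable def twist {v : Plane} (hv : v ∈ N) (z : ℂˣ) (t : Torus N) : Torus N :=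
  ⟨fun m => (z : ℂ) ^ ⌊m.1 v⌋ * t.1 m, by
    change (z : ℂ) ^ ⌊(0 : Module.Dual ℝ Plane) v⌋ * t.1 0 = 1
    rw [t.2.1]
    simp, by
    rintro ⟨m, hm⟩ ⟨m', hm'⟩
    change (z : ℂ) ^ ⌊(m + m') v⌋ * t.1 (⟨m, hm⟩ + ⟨m', hm'⟩) =
      (z : ℂ) ^ ⌊m v⌋ * t.1 ⟨m, hm⟩ * ((z : ℂ) ^ ⌊m' v⌋ * t.1 ⟨m', hm'⟩)
    rw [t.2.2, floor_add hm hv, zpow_add₀ z.ne_zero]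
    ring⟩

theorem twist_apply {v : Plane} (hv : v ∈ N) (z : ℂˣ) (t : Torus N) (m : semigroup N ⊥) :
    (twist hv z t).1 m = (z : ℂ) ^ ⌊m.1 v⌋ * t.1 m :=
  rfl

/-- Equivariance is definitional: both sides multiply `t (m ∘ φ)` by `z ^ ⌊m (φ v)⌋`. -/
theorem monomialMap_twist (φ : Plane →ₗ[ℝ] Plane) (hφ : ∀ n ∈ N, φ n ∈ N) {v : Plane}
    (hv : v ∈ N) (z : ℂˣ) (t : Torus N) :
    monomialMap φ hφ (twist hv z t) = twist (hφ v hv) z (monomialMap φ hφ t) :=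
  rfl

/-- The character `m ∈ S_σ` is multiplied by `2 ^ (-k m(v))` with `m(v) ≥ 0`, which is constantly 1
or tends to 0. -/
theorem tendsto_twist {σ : Cone} {v : Plane} (hv : v ∈ N) (hvσ : v ∈ σ) (t : Torus N) :
    Tendsto (fun k : ℕ => (twist hv ((Units.mk0 (2⁻¹ : ℂ) (by norm_num)) ^ k) t).map
      (bot_le : ⊥ ≤ σ)) atTop (𝓝 (limitPoint σ hvσ t)) := by
  rw [tendsto_iff]
  rintro ⟨m, hm⟩
  change Tendsto (fun k : ℕ => (((Units.mk0 (2⁻¹ : ℂ) (by norm_num)) ^ k : ℂˣ) : ℂ) ^ ⌊m v⌋ *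
    t.1 ⟨m, semigroup_anti N bot_le hm⟩) atTop _
  by_cases h : m v = 0
  · rw [limitPoint_of_eq_zero hvσ t hm h, h]
    simp
  · rw [limitPoint_of_ne_zero hvσ t hm h]
    have h0 : 0 < m v := lt_of_le_of_ne (hm.2 v hvσ) (Ne.symm h)
    rw [← floor_cast hm hv] at h0
    obtain ⟨j, hj⟩ := Int.eq_ofNat_of_zero_le (Int.cast_pos.1 h0).le
    rw [hj] at h0 ⊢
    have hj0 : j ≠ 0 := by
      rintro rfl
      simp at h0
    have : Tendsto (fun k : ℕ => ((2⁻¹ : ℂ) ^ j) ^ k) atTop (𝓝 0) := by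
      refine tendsto_pow_atTop_nhds_zero_of_norm_lt_one ?_
      rw [norm_pow, norm_inv]
      exact pow_lt_one₀ (by positivity) (by norm_num) hj0
    have h' := this.mul_const (t.1 ⟨m, semigroup_anti N bot_le hm⟩)
    rw [zero_mul] at h'
    refine h'.congr fun k => ?_
    rw [Units.val_pow_eq_pow_val, Units.val_mk0, zpow_natCast, ← pow_mul,
      ← pow_mul, mul_comm k j]

end Chart

namespace Fan

variable (Δ : Fan N)

/-- The embedding of the chart `U_σ` in the toric surface. -/
def chartEmb {σ : Cone} (hσ : σ ∈ Δ.cones) (u : Chart N σ) : Δ.Surface :=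
  Quot.mk _ ⟨⟨σ, hσ⟩, u⟩

theorem continuous_chartEmb {σ : Cone} (hσ : σ ∈ Δ.cones) : Continuous (Δ.chartEmb hσ) :=
  continuous_quot_mk.comp
    (continuous_sigmaMk (σ := fun τ : Δ.cones => Chart N τ.1) (i := ⟨σ, hσ⟩))

theorem chartEmb_map {σ τ : Cone} (hσ : σ ∈ Δ.cones) (hτ : τ ∈ Δ.cones) (h : σ ≤ τ)
    (u : Chart N σ) : Δ.chartEmb hτ (u.map h) = Δ.chartEmb hσ u :=
  (Quot.sound ⟨u.map (le_inf le_rfl h), rfl, rfl⟩).symm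

theorem torusEmb_eq {σ : Cone} (hσ : σ ∈ Δ.cones) (t : Torus N) :
    Δ.torusEmb t = Δ.chartEmb hσ (t.map bot_le) :=
  (Δ.chartEmb_map Δ.zero_mem hσ bot_le t).symm

theorem exists_chartEmb (p : Δ.Surface) :
    ∃ (σ : Cone) (hσ : σ ∈ Δ.cones) (u : Chart N σ), Δ.chartEmb hσ u = p := by
  obtain ⟨⟨⟨σ, hσ⟩, u⟩, rfl⟩ := Quot.exists_rep p
  exact ⟨σ, hσ, u, rfl⟩

open Chart in
-- The source of all known graph points: let `z → 0` in the pair `(λ_v(z) t, λ_{φ v}(z) f(t))`.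
theorem limitPoint_mem_graph (φ : Plane →ₗ[ℝ] Plane) (hφ : ∀ n ∈ N, φ n ∈ N) {σ σ' : Cone}
    (hσ : σ ∈ Δ.cones) (hσ' : σ' ∈ Δ.cones) {v : Plane} (hv : v ∈ N) (hvσ : v ∈ σ)
    (hvσ' : φ v ∈ σ') (t : Torus N) :
    (Δ.chartEmb hσ (limitPoint σ hvσ t),
      Δ.chartEmb hσ' (limitPoint σ' hvσ' (monomialMap φ hφ t))) ∈ Δ.graph φ hφ := by
  refine mem_closure_of_tendsto
    ((((Δ.continuous_chartEmb hσ).tendsto _).comp (tendsto_twist hv hvσ t)).prodMk_nhds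
    (((Δ.continuous_chartEmb hσ').tendsto _).comp
      (tendsto_twist (hφ v hv) hvσ' (monomialMap φ hφ t)))) (Eventually.of_forall fun k => ?_)
  refine ⟨twist hv ((Units.mk0 (2⁻¹ : ℂ) (by norm_num)) ^ k) t, ?_⟩
  exact Prod.ext (Δ.torusEmb_eq hσ _) (Δ.torusEmb_eq hσ' _)

end Fan

/-! ### Injectivity of the charts into the glued surface. -/

/-- The point `u` of `U_σ` extends to a semigroup homomorphism with value `z` at `m`. -/
def Chart.HasVal {σ : Cone} (u : Chart N σ) (m : Module.Dual ℝ Plane) (z : ℂ) : Prop :=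
  ∃ a b : semigroup N σ, a.1 = m + b.1 ∧ u.1 b ≠ 0 ∧ u.1 a = z * u.1 b

theorem Chart.HasVal.unique {σ : Cone} {u : Chart N σ} {m : Module.Dual ℝ Plane} {z z' : ℂ}
    (h : u.HasVal m z) (h' : u.HasVal m z') : z = z' := by
  obtain ⟨a, b, hab, hb, h⟩ := h
  obtain ⟨a', b', hab', hb', h'⟩ := h'
  have : a + b' = a' + b := Subtype.ext (by
    change a.1 + b'.1 = a'.1 + b.1
    rw [hab, hab']
    abel)
  have h2 := congrArg u.1 this
  rw [u.2.2, u.2.2, h, h'] at h2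
  exact mul_right_cancel₀ (mul_ne_zero hb hb') (by linear_combination h2)

theorem Chart.hasVal_apply {σ : Cone} (u : Chart N σ) (m : semigroup N σ) :
    u.HasVal m.1 (u.1 m) :=
  ⟨m, 0, by simp, by simp [u.2.1], by simp [u.2.1]⟩

/-- `m₀` is the sum of the coordinate forms of the basis vectors outside `τ`. It vanishes on `τ` and
is 1 on each of those vectors, so a large multiple repairs every negative value of `m`. -/
theorem LatticeBasis.exists_localization (B : LatticeBasis N) {I : Set (Fin 2)} {τ : Cone}
    (h : τ.IsFaceOf (PointedCone.hull ℝ (B.vec '' I))) :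
    ∃ m₀ ∈ semigroup N (PointedCone.hull ℝ (B.vec '' I)), -m₀ ∈ semigroup N τ ∧
      ∀ m ∈ semigroup N τ, ∃ k : ℕ, m + k • m₀ ∈ semigroup N (PointedCone.hull ℝ (B.vec '' I)) := by
  classical
  let c : Fin 2 → ℝ := fun i => if B.vec i ∈ τ then 0 else 1
  let m₀ : Module.Dual ℝ Plane := c 0 • B.coord 0 + c 1 • B.coord 1
  have hc0 : ∀ i, 0 ≤ c i := fun i => by dsimp only [c]; split_ifs <;> simp
  have hm₀ : ∀ x, m₀ x = c 0 * B.coord 0 x + c 1 * B.coord 1 x := fun x => rfl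
  have hint : ∀ n ∈ N, ∃ k : ℤ, m₀ n = k := by
    intro n hn
    obtain ⟨k, hk⟩ := B.coord_int 0 n hn
    obtain ⟨l, hl⟩ := B.coord_int 1 n hn
    have hc : ∀ i, ∃ e : ℤ, c i = e := fun i => by
      dsimp only [c]; split_ifs
      · exact ⟨0, by simp⟩
      · exact ⟨1, by simp⟩
    obtain ⟨e, he⟩ := hc 0
    obtain ⟨f, hf⟩ := hc 1
    exact ⟨e * k + f * l, by rw [hm₀, hk, hl, he, hf]; push_cast; ring⟩
  have hmem : m₀ ∈ semigroup N (PointedCone.hull ℝ (B.vec '' I)) := by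
    refine ⟨hint, fun x hx => ?_⟩
    rw [B.mem_hull_iff] at hx
    rw [hm₀]
    exact add_nonneg (mul_nonneg (hc0 0) (hx 0).1) (mul_nonneg (hc0 1) (hx 1).1)
  refine ⟨m₀, hmem, ⟨neg_integral hint, fun x hx => ?_⟩, fun m hm => ?_⟩
  · have key : ∀ i, c i * B.coord i x = 0 := fun i => by
      by_cases h0 : 0 < B.coord i x
      · simp [c, B.mem_face_of_coord_pos h hx h0]
      · rw [le_antisymm (not_lt.1 h0) ((B.mem_hull_iff I x).1 (h.le hx) i).1, mul_zero]
    rw [LinearMap.neg_apply, hm₀, key, key]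
    simp
  · obtain ⟨k, hk⟩ := exists_nat_ge (|m (B.vec 0)| + |m (B.vec 1)|)
    refine ⟨k, fun n hn => ?_, fun x hx => ?_⟩
    · obtain ⟨a, ha⟩ := hm.1 n hn
      obtain ⟨b, hb⟩ := hint n hn
      exact ⟨a + k * b, by simp [ha, hb]⟩
    · rw [B.mem_hull_iff] at hx
      have key : ∀ i, 0 ≤ m (B.vec i) + k * c i := fun i => by
        by_cases hi : B.vec i ∈ τ
        · simpa [c, hi] using hm.2 _ hi
        · have h1 : |m (B.vec i)| ≤ k := by
            refine le_trans ?_ hk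
            fin_cases i
            · exact le_add_of_nonneg_right (abs_nonneg _)
            · exact le_add_of_nonneg_left (abs_nonneg _)
          have := neg_abs_le (m (B.vec i))
          simp only [c, hi, if_false]
          linarith
      have : (m + k • m₀) x = B.coord 0 x * (m (B.vec 0) + k * c 0) +
          B.coord 1 x * (m (B.vec 1) + k * c 1) := by
        rw [LinearMap.add_apply, LinearMap.smul_apply, hm₀, B.apply_eq m x, nsmul_eq_mul]
        ring
      rw [this]
      exact add_nonneg (mul_nonneg (hx 0).1 (key 0)) (mul_nonneg (hx 1).1 (key 1))

/-- `S_τ` is the localization of `S_σ` at `m₀`, so a fraction over `τ` becomes one over `σ` after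
expanding by a power of `m₀`, which is invertible on `U_τ`. -/
theorem LatticeBasis.hasVal_map_iff (B : LatticeBasis N) {I : Set (Fin 2)} {σ τ : Cone}
    (hσ : σ = PointedCone.hull ℝ (B.vec '' I)) (h : τ.IsFaceOf σ)
    (w : Chart N τ) (m : Module.Dual ℝ Plane) (z : ℂ) :
    (w.map h.le).HasVal m z ↔ w.HasVal m z := by
  subst hσ
  constructor
  · rintro ⟨a, b, hab, hb, h'⟩
    exact ⟨⟨a.1, semigroup_anti N h.le a.2⟩, ⟨b.1, semigroup_anti N h.le b.2⟩, hab, hb, h'⟩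
  · rintro ⟨⟨a, ha⟩, ⟨b, hb⟩, hab, hb0, hz⟩
    obtain ⟨m₀, hm₀, hm₀', hk⟩ := B.exists_localization h
    obtain ⟨k, hka⟩ := hk a ha
    obtain ⟨l, hlb⟩ := hk b hb
    have hm₀τ := semigroup_anti N h.le hm₀
    have hnsmul : ∀ j : ℕ, j • m₀ ∈ semigroup N τ := fun j => nsmul_mem hm₀τ j
    have hne : ∀ j : ℕ, w.1 ⟨j • m₀, hnsmul j⟩ ≠ 0 := fun j =>
      w.apply_ne_zero (hnsmul j) (by rw [← neg_nsmul]; exact nsmul_mem hm₀' j)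
    refine ⟨⟨a + (k + l) • m₀, ?_⟩, ⟨b + (k + l) • m₀, ?_⟩, ?_, ?_, ?_⟩
    · rw [add_smul, ← add_assoc]
      exact add_mem hka (nsmul_mem hm₀ l)
    · rw [add_comm k l, add_smul, ← add_assoc]
      exact add_mem hlb (nsmul_mem hm₀ k)
    · change a + _ = m + (b + _)
      rw [← add_assoc]
      exact congrArg (· + _) hab
    · change w.1 ⟨b + (k + l) • m₀, _⟩ ≠ 0
      rw [w.apply_add hb (hnsmul (k + l)) _ rfl]
      exact mul_ne_zero hb0 (hne _)
    · change w.1 ⟨a + (k + l) • m₀, _⟩ = z * w.1 ⟨b + (k + l) • m₀, _⟩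
      rw [w.apply_add hb (hnsmul (k + l)) _ rfl, w.apply_add ha (hnsmul (k + l)) _ rfl, hz]
      ring

/-- Every cone of the fan is generated by part of a lattice basis of the plane. -/
def Fan.Smooth (Δ : Fan N) : Prop :=
  ∀ σ ∈ Δ.cones, ∃ (B : LatticeBasis N) (I : Set (Fin 2)), σ = PointedCone.hull ℝ (B.vec '' I)

theorem Fan.chartEmb_injective {Δ : Fan N} (hΔ : Δ.Smooth) {σ : Cone} (hσ : σ ∈ Δ.cones) :
    Function.Injective (Δ.chartEmb hσ) := by
  intro u u' huu'
  -- The values of characters are invariant under `Glued`, hence descend to the quotient.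
  -- Transitivity of `Glued` plays no role.
  let P : Module.Dual ℝ Plane → ℂ → Δ.Surface → Prop := fun m z =>
    Quot.lift (fun p => p.2.HasVal m z) (by
      rintro ⟨⟨σ, hσ⟩, u⟩ ⟨⟨τ, hτ⟩, u'⟩ ⟨w, hw, hw'⟩
      obtain ⟨B, I, hB⟩ := hΔ σ hσ
      obtain ⟨B', I', hB'⟩ := hΔ τ hτ
      have hface : (σ ⊓ τ).IsFaceOf τ := by
        rw [inf_comm]
        exact Δ.inter_face τ hτ σ hσ
      dsimp only at hw hw' ⊢
      rw [← hw, ← hw', eq_iff_iff]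
      exact (B.hasVal_map_iff hB (Δ.inter_face σ hσ τ hτ) w m z).trans
        (B'.hasVal_map_iff hB' hface w m z).symm)
  refine Subtype.ext (funext fun m => ?_)
  have h1 : P m.1 (u.1 m) (Δ.chartEmb hσ u) := u.hasVal_apply m
  have h2 : P m.1 (u'.1 m) (Δ.chartEmb hσ u') := u'.hasVal_apply m
  rw [huu'] at h1
  exact Chart.HasVal.unique (u := u') h1 h2

end Toric

/-! ### Stability forces rays to be mapped to rays. -/

namespace Toric

open Filter Topology

variable {N : Submodule ℤ Plane}

theorem mem_hull_singleton {x y : Plane} :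
    x ∈ PointedCone.hull ℝ {y} ↔ ∃ c : ℝ, 0 ≤ c ∧ c • y = x := by
  rw [PointedCone.hull, Submodule.mem_span_singleton]
  exact ⟨fun ⟨a, ha⟩ => ⟨a.1, a.2, ha⟩, fun ⟨c, hc, h⟩ => ⟨⟨c, hc⟩, h⟩⟩

theorem hull_singleton_smul {c : ℝ} (hc : 0 < c) (x : Plane) :
    PointedCone.hull ℝ {c • x} = PointedCone.hull ℝ {x} := by
  ext y
  rw [mem_hull_singleton, mem_hull_singleton]
  constructor
  · rintro ⟨a, ha, rfl⟩
    exact ⟨a * c, by positivity, by rw [mul_smul]⟩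
  · rintro ⟨a, ha, rfl⟩
    exact ⟨a / c, by positivity, by rw [smul_smul, div_mul_cancel₀ _ hc.ne']⟩

theorem LatticeBasis.exists_vec_not_mem_span (B : LatticeBasis N) (x : Plane) :
    ∃ i, ∀ c : ℝ, B.vec i ≠ c • x := by
  by_contra! h
  obtain ⟨c, hc⟩ := h 0
  obtain ⟨d, hd⟩ := h 1
  have hc0 : c ≠ 0 := by
    rintro rfl
    exact B.vec_ne_zero 0 (by simpa using hc)
  have h1 : B.coord 1 x = 0 := by
    have := B.coord_vec 1 0
    rw [hc, map_smul, smul_eq_mul] at this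
    simpa [hc0] using this
  have := B.coord_vec 1 1
  rw [hd, map_smul, h1] at this
  simp at this

namespace Fan

variable (Δ : Fan N)

/-- The vector `x` spans a cone of the fan. -/
def RayPt (x : Plane) : Prop := PointedCone.hull ℝ {x} ∈ Δ.cones

/-- The vector `x` lies in the interior of a two-dimensional cone of the fan. -/
def IntPt (x : Plane) : Prop :=
  ∃ B : LatticeBasis N, PointedCone.hull ℝ (Set.range B.vec) ∈ Δ.cones ∧ ∀ i, 0 < B.coord i x

variable {Δ}

theorem rayPt_smul_iff {c : ℝ} (hc : 0 < c) {x : Plane} : Δ.RayPt (c • x) ↔ Δ.RayPt x := by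
  rw [RayPt, RayPt, hull_singleton_smul hc]

theorem rayPt_vec (B : LatticeBasis N) {I : Set (Fin 2)}
    (h : PointedCone.hull ℝ (B.vec '' I) ∈ Δ.cones) {i : Fin 2} (hi : i ∈ I) :
    Δ.RayPt (B.vec i) := by
  have := Δ.face_mem _ h _ (B.isFaceOf_hull (Set.singleton_subset_iff.2 hi))
  rwa [Set.image_singleton] at this

theorem rayPt_vec_of_range (B : LatticeBasis N)
    (h : PointedCone.hull ℝ (Set.range B.vec) ∈ Δ.cones) (i : Fin 2) : Δ.RayPt (B.vec i) :=
  rayPt_vec B (I := Set.univ) (by rwa [Set.image_univ]) (Set.mem_univ i)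

theorem rayPt_or_intPt (hΔ : Δ.Smooth) {x : Plane} (hx : x ∈ Δ.support) (hx0 : x ≠ 0) :
    Δ.RayPt x ∨ Δ.IntPt x := by
  obtain ⟨σ, hσ, hxσ⟩ := hx
  obtain ⟨B, I, rfl⟩ := hΔ σ hσ
  have hx' := (B.mem_hull_iff I x).1 hxσ
  have hmem : ∀ i, B.coord i x ≠ 0 → i ∈ I := fun i hi => by
    by_contra h
    exact hi ((hx' i).2 h)
  have hray : ∀ i j, i ≠ j → B.coord i x = 0 → Δ.RayPt x := by
    intro i j hij hi
    have hxj : B.coord j x • B.vec j = x := by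
      refine B.ext_coord fun k => ?_
      rw [map_smul, B.coord_vec, smul_eq_mul]
      by_cases hk : k = j
      · subst hk; simp
      · have : k = i := by omega
        simp [this, hi, hij]
    have h0 : B.coord j x ≠ 0 := fun h => hx0 (by rw [← hxj, h, zero_smul])
    rw [← hxj]
    exact (rayPt_smul_iff (lt_of_le_of_ne (hx' j).1 h0.symm)).2 (rayPt_vec B hσ (hmem j h0))
  by_cases h0 : B.coord 0 x = 0
  · exact Or.inl (hray 0 1 (by simp) h0)
  by_cases h1 : B.coord 1 x = 0
  · exact Or.inl (hray 1 0 (by simp) h1)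
  have hI : I = Set.univ := by
    rw [Set.eq_univ_iff_forall, Fin.forall_fin_two]
    exact ⟨hmem 0 h0, hmem 1 h1⟩
  rw [hI, Set.image_univ] at hσ
  refine Or.inr ⟨B, hσ, ?_⟩
  rw [Fin.forall_fin_two]
  exact ⟨lt_of_le_of_ne (hx' 0).1 (Ne.symm h0), lt_of_le_of_ne (hx' 1).1 (Ne.symm h1)⟩

theorem IntPt.not_rayPt {x : Plane} (h : Δ.IntPt x) : ¬ Δ.RayPt x := by
  intro hr
  obtain ⟨B, hB, hx⟩ := h
  have hface := Δ.inter_face _ hB _ hr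
  have hx1 : x ∈ PointedCone.hull ℝ {x} := mem_hull_singleton.2 ⟨1, zero_le_one, one_smul _ _⟩
  have hx2 := (B.mem_hull_range_iff x).2 fun i => (hx i).le
  rw [← Set.image_univ] at hface hx2
  have h0 := (B.mem_face_of_coord_pos hface ⟨hx2, hx1⟩ (hx 0)).2
  obtain ⟨c, -, hc⟩ := mem_hull_singleton.1 h0
  have h1 : c * B.coord 1 x = 0 := by
    rw [← smul_eq_mul, ← map_smul, hc, B.coord_vec]
    simp
  have hc0 := (mul_eq_zero.1 h1).resolve_right (hx 1).ne'
  exact B.vec_ne_zero 0 (by rw [← hc, hc0, zero_smul])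

theorem RayPt.exists_vec (hΔ : Δ.Smooth) {x : Plane} (h : Δ.RayPt x) (hx : x ≠ 0) :
    ∃ (B : LatticeBasis N) (i : Fin 2) (c : ℝ), 0 < c ∧ x = c • B.vec i := by
  obtain ⟨B, I, hB⟩ := hΔ _ h
  have hx1 : x ∈ PointedCone.hull ℝ {x} := mem_hull_singleton.2 ⟨1, zero_le_one, one_smul _ _⟩
  have hI : ∃ i, i ∈ I := by
    by_contra! hI
    rw [hB, Set.eq_empty_of_forall_notMem hI] at hx1
    simp at hx1
    exact hx hx1
  obtain ⟨i, hi⟩ := hI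
  have h2 := B.vec_mem_hull hi
  rw [← hB] at h2
  obtain ⟨c, hc, hcx⟩ := mem_hull_singleton.1 h2
  have hc0 : c ≠ 0 := by
    rintro rfl
    exact B.vec_ne_zero i (by rw [← hcx, zero_smul])
  exact ⟨B, i, c⁻¹, inv_pos.2 (lt_of_le_of_ne hc hc0.symm), by
    rw [← hcx, smul_smul, inv_mul_cancel₀ hc0, one_smul]⟩

/-- The limit is the torus-fixed point of the chart: a character of `S_σ` vanishing at an interior
point of `σ` is zero. -/
theorem IntPt.exists_limitPoint_const {x : Plane} (h : Δ.IntPt x) :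
    ∃ (σ : Cone) (_ : σ ∈ Δ.cones) (hx : x ∈ σ),
      ∀ t t' : Torus N, Chart.limitPoint σ hx t = Chart.limitPoint σ hx t' := by
  obtain ⟨B, hB, hx⟩ := h
  refine ⟨_, hB, (B.mem_hull_range_iff x).2 fun i => (hx i).le, fun t t' => ?_⟩
  refine Subtype.ext (funext ?_)
  rintro ⟨m, hm⟩
  by_cases h0 : m x = 0
  · rw [Chart.limitPoint_of_eq_zero _ _ hm h0, Chart.limitPoint_of_eq_zero _ _ hm h0]
    have hv : ∀ i, 0 ≤ m (B.vec i) := fun i => hm.2 _ (Submodule.subset_span ⟨i, rfl⟩)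
    rw [B.apply_eq, add_eq_zero_iff_of_nonneg (mul_nonneg (hx 0).le (hv 0))
      (mul_nonneg (hx 1).le (hv 1)), mul_eq_zero_iff_left (hx 0).ne',
      mul_eq_zero_iff_left (hx 1).ne'] at h0
    have hm0 : m = 0 := B.form_ext (by
      rw [Fin.forall_fin_two]
      exact ⟨by simpa using h0.1, by simpa using h0.2⟩)
    rw [t.apply_zero _ hm0, t'.apply_zero _ hm0]
  · rw [Chart.limitPoint_of_ne_zero _ _ hm h0, Chart.limitPoint_of_ne_zero _ _ hm h0]

/-- The element `exp r` of `ℂˣ`. -/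
noncomputable def expUnit (r : ℝ) : ℂˣ :=
  Units.mk0 ((Real.exp r : ℝ) : ℂ) (by exact_mod_cast (Real.exp_pos r).ne')

/-- The orbit of a ray is a curve. The coordinate form that vanishes on `x` is a coordinate on it,
and is non-zero at `n`, so the real translates by `n` give uncountably many points. -/
theorem limitPoint_twist_injective (hΔ : Δ.Smooth) {x : Plane} (hx : x ≠ 0) (h : Δ.RayPt x)
    (hxm : x ∈ PointedCone.hull ℝ {x}) {n : Plane} (hn : n ∈ N) (hnx : ∀ c : ℝ, n ≠ c • x)
    (t : Torus N) :
    Function.Injective fun r : ℝ =>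
      Δ.chartEmb h (Chart.limitPoint _ hxm (Chart.twist hn (expUnit r) t)) := by
  intro r s hrs
  have hrs' := chartEmb_injective hΔ h hrs
  obtain ⟨B, i, c, hc, hxc⟩ := h.exists_vec hΔ hx
  have hij : 1 - i ≠ i := by omega
  have hmx : B.coord (1 - i) x = 0 := by
    rw [hxc, map_smul, B.coord_vec, if_neg hij, smul_zero]
  have hm : B.coord (1 - i) ∈ semigroup N (PointedCone.hull ℝ {x}) := by
    refine ⟨B.coord_int _, fun y hy => ?_⟩
    obtain ⟨a, -, rfl⟩ := mem_hull_singleton.1 hy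
    rw [map_smul, hmx, smul_zero]
  have hmn : B.coord (1 - i) n ≠ 0 := by
    intro h0
    refine hnx (B.coord i n * c⁻¹) (B.ext_coord fun j => ?_)
    by_cases hj : j = i
    · subst hj
      rw [hxc, smul_smul, mul_assoc, inv_mul_cancel₀ hc.ne', map_smul, B.coord_vec]
      simp
    · have : j = 1 - i := by omega
      rw [this, h0, map_smul, hmx, smul_zero]
  have hval := congrFun (congrArg Subtype.val hrs') ⟨_, hm⟩
  rw [Chart.limitPoint_of_eq_zero _ _ hm hmx, Chart.limitPoint_of_eq_zero _ _ hm hmx,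
    Chart.twist_apply, Chart.twist_apply] at hval
  replace hval := mul_right_cancel₀ (t.torus_apply_ne_zero _) hval
  rw [expUnit, expUnit, Units.val_mk0, Units.val_mk0, ← Complex.ofReal_zpow, ← Complex.ofReal_zpow, Complex.ofReal_inj] at hval
  replace hval := congrArg Real.log hval
  rw [Real.log_zpow, Real.log_zpow, Real.log_exp, Real.log_exp, floor_cast hm hn] at hval
  exact mul_left_cancel₀ hmn hval

section Stable

variable {φ : Plane →ₗ[ℝ] Plane} {hφ : ∀ n ∈ N, φ n ∈ N}

/-- A fixed point whose direction `y` is sent to a ray is blown up: it is the limit for every `t`,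
while the image limits vary along the curve of `φ y`. -/
theorem exists_limitPoint_mem_indeterminacy (hΔ : Δ.Smooth) (hinj : Function.Injective φ)
    {y : Plane} (hyN : y ∈ N) (hy : Δ.IntPt y) (hray : Δ.RayPt (φ y)) :
    ∃ (σ : Cone) (hσ : σ ∈ Δ.cones) (hyσ : y ∈ σ), ∀ t : Torus N,
      Δ.chartEmb hσ (Chart.limitPoint σ hyσ t) ∈ Δ.indeterminacy φ hφ := by
  obtain ⟨σ, hσ, hyσ, hconst⟩ := hy.exists_limitPoint_const
  refine ⟨σ, hσ, hyσ, fun t => ?_⟩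
  rintro ⟨q, -, hq⟩
  have hy0 : y ≠ 0 := by
    rintro rfl
    obtain ⟨B, -, hB⟩ := hy
    simpa using hB 0
  obtain ⟨B, -, -⟩ := hy
  obtain ⟨i, hi⟩ := B.exists_vec_not_mem_span y
  have hxm : φ y ∈ PointedCone.hull ℝ {φ y} :=
    mem_hull_singleton.2 ⟨1, zero_le_one, one_smul _ _⟩
  have hval : ∀ r : ℝ, Δ.chartEmb hray (Chart.limitPoint _ hxm
      (Chart.twist (hφ _ (B.vec_mem i)) (expUnit r) (monomialMap φ hφ t))) = q := by
    intro r
    apply hq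
    rw [← Chart.monomialMap_twist, hconst t (Chart.twist (B.vec_mem i) (expUnit r) t)]
    exact Δ.limitPoint_mem_graph φ hφ hσ hray hyN hyσ hxm _
  have h01 : (0 : ℝ) = 1 := limitPoint_twist_injective hΔ
    (fun h => hy0 (hinj (by rw [h, map_zero]))) hray hxm (hφ _ (B.vec_mem i))
    (fun c hc => hi c (hinj (by rw [hc, map_smul]))) (monomialMap φ hφ t)
    ((hval 0).trans (hval 1).symm)
  exact zero_ne_one h01

/-- The fixed point of `y` is followed through the fixed points of `φ y, φ² y, …` up to the first
iterate that is a ray. -/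
theorem exists_limitPoint_mem_iterate (hΔ : Δ.Smooth) (hsupp : Δ.support = Set.univ)
    (hinj : Function.Injective φ) (k : ℕ) {y : Plane} (hyN : y ∈ N) (hy : Δ.IntPt y)
    (hray : Δ.RayPt (φ^[k + 1] y)) :
    ∃ (j : ℕ) (σ : Cone) (hσ : σ ∈ Δ.cones) (hyσ : y ∈ σ), ∀ t : Torus N,
      Δ.chartEmb hσ (Chart.limitPoint σ hyσ t) ∈
        (Δ.totalPreimage φ hφ)^[j] (Δ.indeterminacy φ hφ) := by
  induction k generalizing y with
  | zero =>
    obtain ⟨σ, hσ, hyσ, h⟩ := exists_limitPoint_mem_indeterminacy (hφ := hφ) hΔ hinj hyN hy hray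
    exact ⟨0, σ, hσ, hyσ, h⟩
  | succ k ih =>
    have hy0 : φ y ≠ 0 := by
      intro h
      have h' : y = 0 := hinj (by rw [h, map_zero])
      subst h'
      obtain ⟨B, -, hB⟩ := hy
      simpa using hB 0
    by_cases hφy : Δ.RayPt (φ y)
    · obtain ⟨σ, hσ, hyσ, h⟩ := exists_limitPoint_mem_indeterminacy (hφ := hφ) hΔ hinj hyN hy hφy
      exact ⟨0, σ, hσ, hyσ, h⟩
    · have hint := (rayPt_or_intPt hΔ (by rw [hsupp]; trivial) hy0).resolve_left hφy
      obtain ⟨j, σ, hσ, hyσ, h⟩ := ih (hφ y hyN) hint hray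
      obtain ⟨τ, hτ, hyτ, -⟩ := hy.exists_limitPoint_const
      refine ⟨j + 1, τ, hτ, hyτ, fun t => ?_⟩
      rw [Function.iterate_succ_apply']
      exact ⟨_, h (monomialMap φ hφ t), Δ.limitPoint_mem_graph φ hφ hτ hσ hyN hyτ hyσ t⟩

theorem AlgebraicallyStable.rayPt_map (hΔ : Δ.Smooth) (hsupp : Δ.support = Set.univ)
    (hinj : Function.Injective φ) (hAS : Δ.AlgebraicallyStable φ hφ) {x : Plane} (hxN : x ∈ N)
    (hx : x ≠ 0) (hray : Δ.RayPt x) {k : ℕ} (hray' : Δ.RayPt (φ^[k + 2] x)) :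
    Δ.RayPt (φ x) := by
  by_contra hφx
  have hint := (rayPt_or_intPt hΔ (x := φ x) (by rw [hsupp]; trivial)
    (fun h => hx (hinj (by rw [h, map_zero])))).resolve_left hφx
  obtain ⟨j, σ, hσ, hyσ, h⟩ := exists_limitPoint_mem_iterate (hφ := hφ) hΔ hsupp hinj k (hφ x hxN)
    hint hray'
  have hxm : x ∈ PointedCone.hull ℝ {x} := mem_hull_singleton.2 ⟨1, zero_le_one, one_smul _ _⟩
  obtain ⟨B, -, -⟩ := hint
  obtain ⟨i, hi⟩ := B.exists_vec_not_mem_span x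
  let t₀ : Torus N := ⟨fun _ => 1, rfl, fun _ _ => (one_mul 1).symm⟩
  have hg := limitPoint_twist_injective hΔ hx hray hxm (B.vec_mem i) hi t₀
  -- The parameters `r` of points of the curve lying in the countable set form a countable set, yet
  -- every real `r` is one.
  have hc := (Set.Countable.preimage_of_injOn hAS hg.injOn)
  refine Set.not_countable_univ (α := ℝ) (hc.mono fun r _ => ?_)
  refine Set.mem_iUnion.2 ⟨j + 1, ?_⟩
  rw [Function.iterate_succ_apply']
  exact ⟨_, h _, Δ.limitPoint_mem_graph φ hφ hray hσ hxN hxm hyσ _⟩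

end Stable

end Fan

end Toric

/-! ### Part (i): the obstruction in `ℤ²`. -/

namespace Toric

theorem mem_stdLattice_iff (x : Plane) : x ∈ stdLattice ↔ ∀ i, ∃ k : ℤ, x i = k := by
  rw [stdLattice, Module.Basis.mem_span_iff_repr_mem]
  simp [eq_comm]

/-- The standard basis of `ℤ²`. -/
noncomputable def stdLatticeBasis : LatticeBasis stdLattice where
  vec i := Pi.single i 1
  coord i := LinearMap.proj i
  vec_mem i := by simpa using single_mem_stdLattice i 1
  coord_int i n hn := (mem_stdLattice_iff n).1 hn i
  coord_vec i j := by simp [Pi.single_apply]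
  sum_coord x := by
    ext i
    fin_cases i <;> simp

theorem isRegular_smooth {Δ : Fan stdLattice} (h : Δ.IsRegular) : Δ.Smooth := by
  intro σ hσ
  obtain ⟨b, I, hI⟩ := h σ hσ
  obtain ⟨B, hB⟩ := exists_latticeBasis_stdLattice b
  exact ⟨B, I, by rw [hI]; congr 2; ext i; rw [hB]⟩

theorem matrixMap_apply (x : Plane) :
    matrixMap !![0, -8; 1, 4] x = ![-8 * x 1, x 0 + 4 * x 1] := by
  ext i
  fin_cases i <;> simp [matrixMap, Matrix.toLin'_apply, Matrix.mulVec, dotProduct]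

theorem matrixMap_iterate (x : Plane) :
    (matrixMap !![0, -8; 1, 4])^[8] x = (4096 : ℝ) • x := by
  simp only [Function.iterate_succ_apply, Function.iterate_zero, id, matrixMap_apply]
  ext i
  fin_cases i <;> simp <;> ring

theorem matrixMap_injective : Function.Injective (matrixMap !![0, -8; 1, 4]) := by
  intro x y h
  have h' := congrArg (matrixMap !![0, -8; 1, 4])^[7] h
  rw [← Function.iterate_succ_apply, ← Function.iterate_succ_apply, matrixMap_iterate,
    matrixMap_iterate] at h'
  exact smul_right_injective Plane (by norm_num : (4096 : ℝ) ≠ 0) h'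

namespace Fan

variable {N : Submodule ℤ Plane} {Δ : Fan N}

/-- Neither `a` nor `b` lies in the interior of the cone around `a + b`, so each has a non-positive
coordinate. It cannot be the same one for both, since the coordinates of the sum are positive;
`swap` fixes the order. -/
theorem exists_cone_of_not_rayPt_add (hΔ : Δ.Smooth) (hsupp : Δ.support = Set.univ) {a b : Plane}
    (ha : Δ.RayPt a) (hb : Δ.RayPt b) (hab0 : a + b ≠ 0) (hab : ¬ Δ.RayPt (a + b)) :
    ∃ B : LatticeBasis N, PointedCone.hull ℝ (Set.range B.vec) ∈ Δ.cones ∧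
      (∀ i, 0 < B.coord i a + B.coord i b) ∧ B.coord 1 a ≤ 0 ∧ B.coord 0 b ≤ 0 := by
  have hsupp' : ∀ x, x ∈ Δ.support := fun x => by rw [hsupp]; trivial
  obtain ⟨B, hB, hpos⟩ := (rayPt_or_intPt hΔ (hsupp' _) hab0).resolve_left hab
  simp only [map_add] at hpos
  have key : ∀ x, Δ.RayPt x → B.coord 0 x ≤ 0 ∨ B.coord 1 x ≤ 0 := by
    intro x hx
    by_contra! h
    exact IntPt.not_rayPt ⟨B, hB, Fin.forall_fin_two.2 h⟩ hx
  have h0 := hpos 0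
  have h1 := hpos 1
  rcases key a ha with ha' | ha' <;> rcases key b hb with hb' | hb'
  · linarith
  · refine ⟨B.swap, by rwa [B.range_swap_vec], fun i => hpos _, ?_, ?_⟩ <;> simpa [LatticeBasis.swap]
  · exact ⟨B, hB, hpos, ha', hb'⟩
  · linarith

end Fan

/-- The determinant of two vectors of the plane. -/
def det₂ (u v : Plane) : ℝ := u 0 * v 1 - u 1 * v 0

theorem LatticeBasis.det₂_eq {N : Submodule ℤ Plane} (B : LatticeBasis N) (u v : Plane) :
    det₂ u v = (B.coord 0 u * B.coord 1 v - B.coord 1 u * B.coord 0 v) *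
      det₂ (B.vec 0) (B.vec 1) := by
  conv_lhs => rw [← B.sum_coord u, ← B.sum_coord v]
  simp only [det₂, Pi.add_apply, Pi.smul_apply, smul_eq_mul]
  ring

theorem LatticeBasis.det₂_vec (B : LatticeBasis stdLattice) :
    det₂ (B.vec 0) (B.vec 1) = 1 ∨ det₂ (B.vec 0) (B.vec 1) = -1 := by
  have h := B.det₂_eq (stdLatticeBasis.vec 0) (stdLatticeBasis.vec 1)
  choose k hk using fun i j => B.coord_int i _ (stdLatticeBasis.vec_mem j)
  choose l hl using fun i j => (mem_stdLattice_iff _).1 (B.vec_mem i) j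
  simp only [hk] at h
  simp only [det₂, hl, stdLatticeBasis] at h ⊢
  simp only [Pi.single_eq_same, ne_eq, zero_ne_one, one_ne_zero, not_false_eq_true,
    Pi.single_eq_of_ne, mul_zero, sub_zero, mul_one] at h
  norm_cast at h ⊢
  exact Int.isUnit_iff.1 (IsUnit.of_mul_eq_one_right _ h.symm)

theorem det₂_matrixMap (u v : Plane) :
    det₂ (matrixMap !![0, -8; 1, 4] u) (matrixMap !![0, -8; 1, 4] v) = 8 * det₂ u v := by
  simp only [det₂, matrixMap_apply, Matrix.cons_val_zero, Matrix.cons_val_one]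
  ring

theorem LatticeBasis.exists_bezout (B : LatticeBasis stdLattice) (i : Fin 2) :
    ∃ p q r s : ℤ, B.vec i 0 = p ∧ B.vec i 1 = q ∧ p * r + q * s = 1 := by
  obtain ⟨p, hp⟩ := (mem_stdLattice_iff _).1 (B.vec_mem i) 0
  obtain ⟨q, hq⟩ := (mem_stdLattice_iff _).1 (B.vec_mem i) 1
  obtain ⟨r, hr⟩ := B.coord_int i _ (stdLatticeBasis.vec_mem 0)
  obtain ⟨s, hs⟩ := B.coord_int i _ (stdLatticeBasis.vec_mem 1)
  refine ⟨p, q, r, s, hp, hq, ?_⟩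
  have h := stdLatticeBasis.apply_eq (B.coord i) (B.vec i)
  rw [B.coord_vec, if_pos rfl, hr, hs] at h
  change 1 = B.vec i 0 * r + B.vec i 1 * s at h
  rw [hp, hq] at h
  exact_mod_cast h.symm

/-- The first coordinate is odd or congruent to `4` modulo `8`. For a primitive vector `v` this
says that `A v` is `1` or `8` times a primitive vector. -/
def OddType (v : Plane) : Prop := ∃ p : ℤ, v 0 = p ∧ (p % 2 = 1 ∨ p % 8 = 4)

theorem oddType_iff {v : Plane} {p : ℤ} (h : v 0 = p) : OddType v ↔ p % 2 = 1 ∨ p % 8 = 4 := by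
  constructor
  · rintro ⟨p', hp', h'⟩
    rw [h, Int.cast_inj] at hp'
    rwa [hp']
  · exact fun h' => ⟨p, h, h'⟩

theorem odd_of_bezout {p q r s : ℤ} (h : p * r + q * s = 1) (hp : p % 2 = 0) : q % 2 = 1 := by
  by_contra hq
  obtain ⟨p', rfl⟩ := Int.dvd_of_emod_eq_zero hp
  obtain ⟨q', rfl⟩ := Int.dvd_of_emod_eq_zero (a := 2) (b := q) (by omega)
  have : 2 * (p' * r + q' * s) = 1 := by linear_combination h
  omega

/-- For primitive `v = (p, q)` the vector `A v = (-8q, p + 4q)` has content 1 if `p` is odd, 2 if `p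
≡ 2` mod 4, 4 if `p ≡ 0` mod 8, and 8 if `p ≡ 4` mod 8. -/
theorem oddType_vec_iff (B B' : LatticeBasis stdLattice) {i j : Fin 2} {x : ℤ} (hx0 : 0 < x)
    (hx : x ∣ 8) (h : matrixMap !![0, -8; 1, 4] (B.vec i) = (x : ℝ) • B'.vec j) :
    OddType (B.vec i) ↔ x = 1 ∨ x = 8 := by
  obtain ⟨p, q, r, s, hp, hq, hpq⟩ := B.exists_bezout i
  obtain ⟨p', q', r', s', hp', hq', hpq'⟩ := B'.exists_bezout j
  rw [oddType_iff hp]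
  rw [matrixMap_apply] at h
  have h0 := congrFun h 0
  have h1 := congrFun h 1
  simp only [Matrix.cons_val_zero, Matrix.cons_val_one, Pi.smul_apply, smul_eq_mul, hp, hq, hp',
    hq'] at h0 h1
  norm_cast at h0 h1
  have ho := odd_of_bezout hpq
  have ho' := odd_of_bezout hpq'
  have hx8 := Int.le_of_dvd (by norm_num) hx
  interval_cases x <;> omega

/-- No interior point of a cone goes to a ray, so the image cone contains no ray inside and must be
a full cone of the fan. The product of the stretching factors is the determinant. -/
theorem exists_basis_map_vec {Δ : Fan stdLattice} (hΔ : Δ.Smooth) (hsupp : Δ.support = Set.univ)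
    (hmap : ∀ x ∈ stdLattice, x ≠ 0 → Δ.RayPt x → Δ.RayPt (matrixMap !![0, -8; 1, 4] x))
    (B : LatticeBasis stdLattice)
    (hB : PointedCone.hull ℝ (Set.range B.vec) ∈ Δ.cones) :
    ∃ (B' : LatticeBasis stdLattice) (x y : ℤ), 0 < x ∧ 0 < y ∧ x * y = 8 ∧
      matrixMap !![0, -8; 1, 4] (B.vec 0) = (x : ℝ) • B'.vec 0 ∧
      matrixMap !![0, -8; 1, 4] (B.vec 1) = (y : ℝ) • B'.vec 1 := by
  set φ := matrixMap !![0, -8; 1, 4] with hφ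
  have hne : ∀ x, x ≠ 0 → φ x ≠ 0 := fun x hx h =>
    hx (matrixMap_injective (by rw [← hφ, h, map_zero]))
  have hiter : ∀ k, ∀ x ∈ stdLattice, x ≠ 0 → Δ.RayPt x → Δ.RayPt (φ^[k] x) := by
    intro k
    induction k with
    | zero => exact fun x _ _ h => h
    | succ k ih =>
      intro x hx hx0 h
      exact ih _ (matrixMap_mem_stdLattice _ x hx) (hne x hx0) (hmap x hx hx0 h)
  -- Seven further applications turn `φ x` into `4096 x`.
  have hback : ∀ x ∈ stdLattice, x ≠ 0 → Δ.RayPt (φ x) → Δ.RayPt x := by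
    intro x hx hx0 h
    have := hiter 7 _ (matrixMap_mem_stdLattice _ x hx) (hne x hx0) h
    rw [← Function.iterate_succ_apply, hφ, matrixMap_iterate] at this
    exact (Fan.rayPt_smul_iff (by norm_num)).1 this
  have hnot : ∀ x ∈ stdLattice, (∀ i, 0 < B.coord i x) → ¬ Δ.RayPt (φ x) := by
    intro x hx hpos h
    refine Fan.IntPt.not_rayPt ⟨B, hB, hpos⟩ (hback x hx ?_ h)
    rintro rfl
    simpa using hpos 0
  have hray : ∀ i, Δ.RayPt (φ (B.vec i)) := fun i =>
    hmap _ (B.vec_mem i) (B.vec_ne_zero i) (Fan.rayPt_vec_of_range B hB i)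
  have hab0 : B.vec 0 + B.vec 1 ≠ 0 := fun h => by
    simpa [B.coord_vec] using congrArg (B.coord 0) h
  obtain ⟨B', hB', hpos, h1, h2⟩ := Fan.exists_cone_of_not_rayPt_add hΔ hsupp (hray 0) (hray 1)
    (by rw [← map_add]; exact hne _ hab0) (by
      rw [← map_add]
      refine hnot _ (add_mem (B.vec_mem 0) (B.vec_mem 1)) ?_
      simp [Fin.forall_fin_two, B.coord_vec])
  choose k hk using fun i j => B'.coord_int i _ (matrixMap_mem_stdLattice !![0, -8; 1, 4] _
    (B.vec_mem j))
  rw [← hφ] at hk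
  have hs0 := B'.sum_coord (φ (B.vec 0))
  have hs1 := B'.sum_coord (φ (B.vec 1))
  have hp0 := hpos 0
  have hp1 := hpos 1
  rw [hk] at h1 h2
  rw [hk, hk] at hp0 hp1 hs0 hs1
  set D : ℝ := k 0 0 * k 1 1 - k 1 0 * k 0 1 with hD
  have hDpos : 0 < D := by nlinarith
  -- Cramer's rule writes `D • B'.vec j` as the image of an integral combination of `B.vec 0` and
  -- `B.vec 1`. Positive coefficients would place a preimage of a ray inside the cone of `B`.
  have hcase : ∀ (j : Fin 2) (a b : ℤ), D • B'.vec j = φ ((a : ℝ) • B.vec 0 + (b : ℝ) • B.vec 1) →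
      0 < a → 0 < b → False := by
    intro j a b h ha hb
    refine hnot ((a : ℝ) • B.vec 0 + (b : ℝ) • B.vec 1) ?_ ?_ ?_
    · rw [Int.cast_smul_eq_zsmul, Int.cast_smul_eq_zsmul]
      exact add_mem (zsmul_mem (B.vec_mem 0) a) (zsmul_mem (B.vec_mem 1) b)
    · simp [Fin.forall_fin_two, B.coord_vec, ha, hb]
    · rw [← h]
      exact (Fan.rayPt_smul_iff hDpos).2 (Fan.rayPt_vec_of_range B' hB' j)
  have hk10 : k 1 0 = 0 := by
    by_contra h0
    refine hcase 0 (k 1 1) (-k 1 0) ?_ ?_ ?_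
    · rw [map_add, map_smul, map_smul, ← hs0, ← hs1, hD]
      push_cast
      module
    · rify; linarith
    · rify at h0 ⊢; exact neg_pos.2 (lt_of_le_of_ne h1 h0)
  have hk01 : k 0 1 = 0 := by
    by_contra h0
    refine hcase 1 (-k 0 1) (k 0 0) ?_ ?_ ?_
    · rw [map_add, map_smul, map_smul, ← hs0, ← hs1, hD]
      push_cast
      module
    · rify at h0 ⊢; exact neg_pos.2 (lt_of_le_of_ne h2 h0)
    · rify; linarith
  rw [hk10, Int.cast_zero, zero_smul, add_zero] at hs0
  rw [hk01, Int.cast_zero, zero_smul, zero_add] at hs1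
  rw [hk01, Int.cast_zero, add_zero, Int.cast_pos] at hp0
  rw [hk10, Int.cast_zero, zero_add, Int.cast_pos] at hp1
  refine ⟨B', k 0 0, k 1 1, hp0, hp1, ?_, hs0.symm, hs1.symm⟩
  have hdet := det₂_matrixMap (B.vec 0) (B.vec 1)
  rw [B'.det₂_eq, ← hφ, hk, hk, hk, hk, hk10, hk01] at hdet
  have h8 : ((k 0 0 * k 1 1 : ℤ) : ℝ) = 8 ∨ ((k 0 0 * k 1 1 : ℤ) : ℝ) = -8 := by
    rcases B.det₂_vec with h | h <;> rcases B'.det₂_vec with h' | h' <;> rw [h, h'] at hdet <;>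
      push_cast at hdet ⊢ <;> first | (left; linarith) | (right; linarith)
  have hpp := mul_pos hp0 hp1
  norm_cast at h8
  omega

/-- In `x y = 8` either both factors lie in `{1, 8}` or both lie in `{2, 4}`. -/
theorem oddType_iff_of_cone {Δ : Fan stdLattice} (hΔ : Δ.Smooth) (hsupp : Δ.support = Set.univ)
    (hmap : ∀ x ∈ stdLattice, x ≠ 0 → Δ.RayPt x → Δ.RayPt (matrixMap !![0, -8; 1, 4] x))
    (B : LatticeBasis stdLattice)
    (hB : PointedCone.hull ℝ (Set.range B.vec) ∈ Δ.cones) :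
    OddType (B.vec 0) ↔ OddType (B.vec 1) := by
  obtain ⟨B', x, y, hx, hy, hxy, h0, h1⟩ := exists_basis_map_vec hΔ hsupp hmap B hB
  rw [oddType_vec_iff B B' hx ⟨y, hxy.symm⟩ h0, oddType_vec_iff B B' hy ⟨x, by rw [mul_comm, hxy]⟩ h1]
  have hx8 : x ≤ 8 := by nlinarith
  interval_cases x <;> omega

/-- Otherwise the cone around the sum is spanned by `P` itself, and the generators of a cone have
equal type. -/
theorem rayPt_add_of_mixed {Δ : Fan stdLattice} (hΔ : Δ.Smooth) (hsupp : Δ.support = Set.univ)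
    (hmap : ∀ x ∈ stdLattice, x ≠ 0 → Δ.RayPt x → Δ.RayPt (matrixMap !![0, -8; 1, 4] x))
    (P : LatticeBasis stdLattice) (hP : ∀ i, Δ.RayPt (P.vec i))
    (hmix : ¬ (OddType (P.vec 0) ↔ OddType (P.vec 1))) : Δ.RayPt (P.vec 0 + P.vec 1) := by
  by_contra hab
  have hab0 : P.vec 0 + P.vec 1 ≠ 0 := fun h => by
    simpa [P.coord_vec] using congrArg (P.coord 0) h
  obtain ⟨B, hB, hpos, h1, h2⟩ :=
    Fan.exists_cone_of_not_rayPt_add hΔ hsupp (hP 0) (hP 1) hab0 hab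
  choose k hk using fun i j => B.coord_int i _ (P.vec_mem j)
  have hs0 := B.sum_coord (P.vec 0)
  have hs1 := B.sum_coord (P.vec 1)
  have hdet := B.det₂_eq (P.vec 0) (P.vec 1)
  have hp0 := hpos 0
  have hp1 := hpos 1
  simp only [hk] at hdet h1 h2 hp0 hp1 hs0 hs1
  have hD : ((k 0 0 * k 1 1 - k 1 0 * k 0 1 : ℤ) : ℝ) ≤ 1 := by
    push_cast
    rcases P.det₂_vec with h | h <;> rcases B.det₂_vec with h' | h' <;> rw [h, h'] at hdet <;>
      linarith
  norm_cast at hD h1 h2 hp0 hp1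
  -- With `s = -k 0 1 ≥ 0` and `u = -k 1 0 ≥ 0`, positivity of the sums gives `k 0 0 ≥ 1 + s` and `k
  -- 1 1 ≥ 1 + u`. The determinant is then at least `1 + s + u`, but it is at most 1.
  have hk10 : k 1 0 = 0 := by nlinarith
  have hk01 : k 0 1 = 0 := by nlinarith
  have hk00 : k 0 0 = 1 := by rw [hk10, hk01] at *; nlinarith
  have hk11 : k 1 1 = 1 := by rw [hk10, hk01] at *; nlinarith
  simp only [hk10, hk01, hk00, hk11, Int.cast_one, Int.cast_zero, one_smul, zero_smul, add_zero,
    zero_add] at hs0 hs1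
  rw [← hs0, ← hs1] at hmix
  exact hmix (oddType_iff_of_cone hΔ hsupp hmap B hB)

theorem exists_large_mixed_basis {Δ : Fan stdLattice} (hΔ : Δ.Smooth) (hsupp : Δ.support = Set.univ)
    (hmap : ∀ x ∈ stdLattice, x ≠ 0 → Δ.RayPt x → Δ.RayPt (matrixMap !![0, -8; 1, 4] x))
    (h0 : ∀ i, Δ.RayPt (stdLatticeBasis.vec i)) (n : ℕ) :
    ∃ P : LatticeBasis stdLattice, (∀ i, Δ.RayPt (P.vec i)) ∧
      ¬ (OddType (P.vec 0) ↔ OddType (P.vec 1)) ∧ (∀ i, 1 ≤ P.vec i 0 + P.vec i 1) ∧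
      (n : ℝ) ≤ (P.vec 0 0 + P.vec 0 1) + (P.vec 1 0 + P.vec 1 1) := by
  induction n with
  | zero =>
    refine ⟨stdLatticeBasis, h0, ?_, ?_, ?_⟩
    · rw [oddType_iff (p := 1) (by simp [stdLatticeBasis]),
        oddType_iff (p := 0) (by simp [stdLatticeBasis])]
      norm_num
    · simp [Fin.forall_fin_two, stdLatticeBasis]
    · simp [stdLatticeBasis]
  | succ n ih =>
    obtain ⟨P, hP, hmix, hone, hn⟩ := ih
    have hadd := rayPt_add_of_mixed hΔ hsupp hmap P hP hmix
    have hone0 := hone 0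
    have hone1 := hone 1
    -- The sum replaces the vector of its own type. As each vector has coordinate sum at least 1,
    -- the total grows by at least 1.
    by_cases hK : OddType (P.vec 0) ↔ OddType (P.vec 0 + P.vec 1)
    · refine ⟨P.addLeft, Fin.forall_fin_two.2 ⟨hadd, hP 1⟩, ?_, ?_, ?_⟩
      · change ¬ (OddType (P.vec 0 + P.vec 1) ↔ OddType (P.vec 1))
        rwa [← hK]
      · simp only [Fin.forall_fin_two, LatticeBasis.addLeft, Matrix.cons_val_zero,
          Matrix.cons_val_one, Pi.add_apply]
        constructor <;> linarith
      · simp only [LatticeBasis.addLeft, Matrix.cons_val_zero,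
          Matrix.cons_val_one, Pi.add_apply]
        push_cast
        linarith
    · refine ⟨P.addRight, Fin.forall_fin_two.2 ⟨hP 0, hadd⟩, hK, ?_, ?_⟩
      · simp only [Fin.forall_fin_two, LatticeBasis.addRight, Matrix.cons_val_zero,
          Matrix.cons_val_one, Pi.add_apply]
        constructor <;> linarith
      · simp only [LatticeBasis.addRight, Matrix.cons_val_zero,
          Matrix.cons_val_one, Pi.add_apply]
        push_cast
        linarith

/-- A ray contains only one primitive vector, so these vectors inject into the finite set of cones.
-/
theorem Fan.finite_primitive_rayPt {N : Submodule ℤ Plane} (Δ : Fan N) :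
    {v | Δ.RayPt v ∧ ∃ (B : LatticeBasis N) (i : Fin 2), B.vec i = v}.Finite := by
  refine Set.Finite.of_injOn (f := fun v => PointedCone.hull ℝ {v}) (t := Δ.cones)
    (fun v hv => hv.1) ?_ Δ.finite
  rintro _ ⟨-, B, i, rfl⟩ _ ⟨-, B', i', rfl⟩ h
  have h1 : B.vec i ∈ PointedCone.hull ℝ {B'.vec i'} := by
    dsimp only at h
    rw [← h]
    exact mem_hull_singleton.2 ⟨1, zero_le_one, one_smul _ _⟩
  obtain ⟨c, hc, hcv⟩ := mem_hull_singleton.1 h1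
  obtain ⟨k, hk⟩ := B.coord_int i _ (B'.vec_mem i')
  obtain ⟨l, hl⟩ := B'.coord_int i' _ (B.vec_mem i)
  have h2 : c = l := by
    rw [← hl, ← hcv, map_smul, B'.coord_vec, if_pos rfl, smul_eq_mul, mul_one]
  have h3 : c * k = 1 := by
    rw [← hk, ← smul_eq_mul, ← map_smul, hcv, B.coord_vec, if_pos rfl]
  rw [h2] at h3 hc
  norm_cast at h3 hc
  have h4 : l = 1 := by
    rcases Int.isUnit_iff.1 (IsUnit.of_mul_eq_one _ h3) with h | h <;> omega
  rw [← hcv, h2, h4, Int.cast_one, one_smul]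

theorem support_fanP1xP1 : fanP1xP1.support = Set.univ := by
  refine Set.eq_univ_of_forall fun x => ?_
  refine ⟨_, ⟨fun i => SignType.sign (x i), rfl⟩, ?_⟩
  rw [mem_signCone]
  exact fun i => ⟨|x i|, abs_nonneg _, (abs_mul_sign (x i)).symm⟩

/-- A cone of the refinement lies in a quadrant, so coordinate `1 - i` has constant sign on it. If
`e_i` were interior, this coordinate would vanish on both generators, which form a basis. -/
theorem Fan.Refines.rayPt_single {Δ : Fan stdLattice} (hΔ : Δ.Smooth) (h : Δ.Refines fanP1xP1)
    (i : Fin 2) : Δ.RayPt (stdLatticeBasis.vec i) := by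
  have hsupp := h.1.trans support_fanP1xP1
  refine (rayPt_or_intPt hΔ (by rw [hsupp]; trivial) (stdLatticeBasis.vec_ne_zero i)).resolve_right ?_
  rintro ⟨B, hB, hpos⟩
  obtain ⟨_, ⟨s, rfl⟩, hs⟩ := h.2 _ hB
  have hmem : ∀ j, B.vec j ∈ signCone s := fun j => hs (Submodule.subset_span ⟨j, rfl⟩)
  have hc : ∀ j, ∃ c : ℝ, 0 ≤ c ∧ B.vec j (1 - i) = c * (s (1 - i) : ℝ) := fun j =>
    (mem_signCone s _).1 (hmem j) (1 - i)
  choose c hc0 hc using hc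
  have hij : 1 - i ≠ i := by omega
  have h0 := B.apply_eq (LinearMap.proj (1 - i)) (stdLatticeBasis.vec i)
  have h1 := B.apply_eq (LinearMap.proj (1 - i)) (stdLatticeBasis.vec (1 - i))
  simp only [LinearMap.proj_apply, hc, stdLatticeBasis, Pi.single_eq_same,
    Pi.single_eq_of_ne hij] at h0 h1 hpos
  have hs0 : (s (1 - i) : ℝ) ≠ 0 := fun h => by simp [h] at h1
  have h2 : B.coord 0 (Pi.single i 1) * c 0 + B.coord 1 (Pi.single i 1) * c 1 = 0 := by
    refine (mul_eq_zero.1 ?_).resolve_right hs0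
    linear_combination -h0
  rw [add_eq_zero_iff_of_nonneg (mul_nonneg (hpos 0).le (hc0 0))
      (mul_nonneg (hpos 1).le (hc0 1)), mul_eq_zero_iff_left (hpos 0).ne',
      mul_eq_zero_iff_left (hpos 1).ne'] at h2
  rw [h2.1, h2.2] at h1
  simp at h1

theorem not_exists_algebraicallyStable_refinement :
    ¬ ∃ Δ' : Fan stdLattice, Δ'.Refines fanP1xP1 ∧ Δ'.IsRegular ∧
      Δ'.AlgebraicallyStable (matrixMap !![0, -8; 1, 4])
        (matrixMap_mem_stdLattice !![0, -8; 1, 4]) := by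
  rintro ⟨Δ, href, hreg, hAS⟩
  have hΔ := isRegular_smooth hreg
  have hsupp := href.1.trans support_fanP1xP1
  have hmap : ∀ x ∈ stdLattice, x ≠ 0 → Δ.RayPt x → Δ.RayPt (matrixMap !![0, -8; 1, 4] x) :=
    -- `k = 6` makes the later iterate `φ ^ 8`, a positive multiple of the identity.
    fun x hx hx0 h => hAS.rayPt_map hΔ hsupp matrixMap_injective hx hx0 h (k := 6) (by
      rw [matrixMap_iterate]
      exact (Fan.rayPt_smul_iff (by norm_num)).2 h)
  obtain ⟨M, hM⟩ := (Δ.finite_primitive_rayPt.image fun v => v 0 + v 1).bddAbove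
  obtain ⟨n, hn⟩ := exists_nat_gt (2 * M)
  obtain ⟨P, hP, -, -, h⟩ :=
    exists_large_mixed_basis hΔ hsupp hmap (href.rayPt_single hΔ) n
  have hle : ∀ i, P.vec i 0 + P.vec i 1 ≤ M := fun i => hM ⟨_, ⟨hP i, P, i, rfl⟩, rfl⟩
  have := hle 0
  have := hle 1
  linarith

end Toric

/-! ### Every point of a smooth toric surface as a limit point. -/

namespace Toric

variable {N : Submodule ℤ Plane}

theorem mem_semigroup_hull_iff (B : LatticeBasis N) (I : Set (Fin 2)) (m : Module.Dual ℝ Plane) :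
    m ∈ semigroup N (PointedCone.hull ℝ (B.vec '' I)) ↔
      (∀ n ∈ N, ∃ k : ℤ, m n = k) ∧ ∀ i ∈ I, 0 ≤ m (B.vec i) := by
  refine ⟨fun h => ⟨h.1, fun i hi => h.2 _ (B.vec_mem_hull hi)⟩, fun h => ⟨h.1, fun x hx => ?_⟩⟩
  rw [B.mem_hull_iff] at hx
  have key : ∀ i, 0 ≤ B.coord i x * m (B.vec i) := fun i => by
    by_cases hi : i ∈ I
    · exact mul_nonneg (hx i).1 (h.2 i hi)
    · rw [(hx i).2 hi, zero_mul]
  rw [B.apply_eq]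
  exact add_nonneg (key 0) (key 1)

theorem Chart.apply_nsmul {σ : Cone} (u : Chart N σ) {m : Module.Dual ℝ Plane}
    (hm : m ∈ semigroup N σ) (k : ℕ) : u.1 ⟨k • m, nsmul_mem hm k⟩ = u.1 ⟨m, hm⟩ ^ k := by
  induction k with
  | zero => exact u.apply_zero _ (zero_smul ℕ m)
  | succ k ih =>
    rw [u.apply_add (nsmul_mem hm k) hm _ (succ_nsmul m k), ih, pow_succ]

theorem Chart.apply_zsmul {σ : Cone} (u : Chart N σ) {m : Module.Dual ℝ Plane}
    (hm : m ∈ semigroup N σ) {k : ℤ} (hk : 0 ≤ k ∨ -m ∈ semigroup N σ)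
    (hkm : k • m ∈ semigroup N σ) : u.1 ⟨k • m, hkm⟩ = u.1 ⟨m, hm⟩ ^ k := by
  obtain ⟨j, rfl | rfl⟩ := k.eq_nat_or_neg
  · have := u.apply_nsmul hm j
    rw [zpow_natCast, ← this]
    congr 2
  · rcases hk with hk | hm'
    · have hj : j = 0 := by omega
      subst hj
      simpa using u.apply_zero _ (by simp)
    · have h1 := u.apply_nsmul hm' j
      have h2 := u.mul_neg_apply hm hm'
      rw [zpow_neg, zpow_natCast, ← inv_pow, inv_eq_of_mul_eq_one_right h2, ← h1]
      simp

theorem LatticeBasis.form_eq (B : LatticeBasis N) {σ : Cone} {m : Module.Dual ℝ Plane}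
    (hm : m ∈ semigroup N σ) :
    m = ⌊m (B.vec 0)⌋ • B.coord 0 + ⌊m (B.vec 1)⌋ • B.coord 1 := by
  refine LinearMap.ext fun x => ?_
  rw [B.apply_eq m x, LinearMap.add_apply, LinearMap.smul_apply, LinearMap.smul_apply,
    zsmul_eq_mul, zsmul_eq_mul, floor_cast hm (B.vec_mem 0), floor_cast hm (B.vec_mem 1)]
  ring

theorem LatticeBasis.chart_apply (B : LatticeBasis N) {σ : Cone} (u : Chart N σ)
    (hc : ∀ i, B.coord i ∈ semigroup N σ) {m : Module.Dual ℝ Plane} (hm : m ∈ semigroup N σ)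
    (hk : ∀ i, 0 ≤ ⌊m (B.vec i)⌋ ∨ -B.coord i ∈ semigroup N σ) :
    u.1 ⟨m, hm⟩ = u.1 ⟨_, hc 0⟩ ^ ⌊m (B.vec 0)⌋ * u.1 ⟨_, hc 1⟩ ^ ⌊m (B.vec 1)⌋ := by
  have hmem : ∀ i, ⌊m (B.vec i)⌋ • B.coord i ∈ semigroup N σ :=
    fun i => by
      rcases hk i with h | h
      · obtain ⟨j, hj⟩ := Int.eq_ofNat_of_zero_le h
        rw [hj, natCast_zsmul]
        exact nsmul_mem (hc i) j
      · obtain ⟨j, hj | hj⟩ := ⌊m (B.vec i)⌋.eq_nat_or_neg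
        · rw [hj, natCast_zsmul]
          exact nsmul_mem (hc i) j
        · rw [hj, neg_smul, ← smul_neg, natCast_zsmul]
          exact nsmul_mem h j
  rw [u.apply_add (hmem 0) (hmem 1) hm (B.form_eq hm), u.apply_zsmul (hc 0) (hk 0),
    u.apply_zsmul (hc 1) (hk 1)]

theorem LatticeBasis.torus_apply (B : LatticeBasis N) (t : Torus N)
    {m : Module.Dual ℝ Plane} (hm : m ∈ semigroup N ⊥) (hc : ∀ i, B.coord i ∈ semigroup N ⊥) :
    t.1 ⟨m, hm⟩ = t.1 ⟨_, hc 0⟩ ^ ⌊m (B.vec 0)⌋ * t.1 ⟨_, hc 1⟩ ^ ⌊m (B.vec 1)⌋ :=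
  B.chart_apply t hc hm fun i => Or.inr (mem_semigroup_bot (neg_integral (B.coord_int i)))

/-- `u` is determined by its values `c i` on the coordinate forms. The direction `v` is the sum of
the basis vectors with `c i = 0`, and `t` has the same coordinates with each 0 replaced by 1. -/
theorem LatticeBasis.exists_eq_limitPoint (B : LatticeBasis N) {I : Set (Fin 2)}
    (u : Chart N (PointedCone.hull ℝ (B.vec '' I))) :
    ∃ (v : Plane) (_ : v ∈ N) (hv : v ∈ PointedCone.hull ℝ (B.vec '' I)) (t : Torus N),
      u = Chart.limitPoint _ hv t := by
  classical
  have hc : ∀ i, B.coord i ∈ semigroup N (PointedCone.hull ℝ (B.vec '' I)) := fun i =>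
    (mem_semigroup_hull_iff B I _).2 ⟨B.coord_int i, fun j _ => by
      rw [B.coord_vec]; split_ifs <;> simp⟩
  have hc' : ∀ i, i ∉ I → -B.coord i ∈ semigroup N (PointedCone.hull ℝ (B.vec '' I)) :=
    fun i hi => (mem_semigroup_hull_iff B I _).2 ⟨neg_integral (B.coord_int i), fun j hj => by
      have : i ≠ j := fun h => hi (h ▸ hj)
      rw [LinearMap.neg_apply, B.coord_vec, if_neg this, neg_zero]⟩
  let c : Fin 2 → ℂ := fun i => u.1 ⟨_, hc i⟩
  have hcI : ∀ i, c i = 0 → i ∈ I := fun i h => by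
    by_contra hi
    exact u.apply_ne_zero (hc i) (hc' i hi) h
  let d : Fin 2 → ℂ := fun i => if c i = 0 then 1 else c i
  have hd : ∀ i, d i ≠ 0 := fun i => by
    dsimp only [d]
    split_ifs with h
    · exact one_ne_zero
    · exact h
  let e : Fin 2 → ℤ := fun i => if c i = 0 then 1 else 0
  let v : Plane := e 0 • B.vec 0 + e 1 • B.vec 1
  have hvN : v ∈ N := add_mem (zsmul_mem (B.vec_mem 0) _) (zsmul_mem (B.vec_mem 1) _)
  have he : ∀ i, 0 ≤ e i := fun i => by dsimp only [e]; split_ifs <;> simp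
  have hmv : ∀ m : Module.Dual ℝ Plane, m v = e 0 * m (B.vec 0) + e 1 * m (B.vec 1) := fun m => by
    simp only [v, map_add, ← Int.cast_smul_eq_zsmul ℝ, map_smul, smul_eq_mul]
  have hv : v ∈ PointedCone.hull ℝ (B.vec '' I) := by
    rw [B.mem_hull_iff]
    have : ∀ i, B.coord i v = e i := fun i => by
      rw [hmv, B.coord_vec, B.coord_vec]
      fin_cases i <;> simp
    intro i
    rw [this]
    exact ⟨by exact_mod_cast he i, fun hi => by
      have : c i ≠ 0 := fun h => hi (hcI i h)
      simp [e, this]⟩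
  let t : Torus N := ⟨fun m => d 0 ^ ⌊m.1 (B.vec 0)⌋ * d 1 ^ ⌊m.1 (B.vec 1)⌋, by
    change d 0 ^ ⌊(0 : Module.Dual ℝ Plane) (B.vec 0)⌋ *
      d 1 ^ ⌊(0 : Module.Dual ℝ Plane) (B.vec 1)⌋ = 1
    simp, by
    rintro ⟨m, hm⟩ ⟨m', hm'⟩
    change d 0 ^ ⌊(m + m') (B.vec 0)⌋ * d 1 ^ ⌊(m + m') (B.vec 1)⌋ =
      d 0 ^ ⌊m (B.vec 0)⌋ * d 1 ^ ⌊m (B.vec 1)⌋ * (d 0 ^ ⌊m' (B.vec 0)⌋ * d 1 ^ ⌊m' (B.vec 1)⌋)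
    rw [floor_add hm (B.vec_mem 0), floor_add hm (B.vec_mem 1), zpow_add₀ (hd 0),
      zpow_add₀ (hd 1)]
    ring⟩
  refine ⟨v, hvN, hv, t, Subtype.ext (funext ?_)⟩
  rintro ⟨m, hm⟩
  rw [B.chart_apply u hc hm fun i => by
    by_cases hi : i ∈ I
    · exact Or.inl (Int.floor_nonneg.2 (hm.2 _ (B.vec_mem_hull hi)))
    · exact Or.inr (hc' i hi)]
  change c 0 ^ ⌊m (B.vec 0)⌋ * c 1 ^ ⌊m (B.vec 1)⌋ = _
  have hterm : ∀ i, 0 ≤ (e i : ℝ) * m (B.vec i) := fun i => by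
    by_cases h : c i = 0
    · exact mul_nonneg (by exact_mod_cast he i) (hm.2 _ (B.vec_mem_hull (hcI i h)))
    · simp [e, h]
  by_cases h0 : m v = 0
  · rw [Chart.limitPoint_of_eq_zero _ _ hm h0]
    rw [hmv, add_eq_zero_iff_of_nonneg (hterm 0) (hterm 1)] at h0
    have key : ∀ i, (e i : ℝ) * m (B.vec i) = 0 → c i ^ ⌊m (B.vec i)⌋ = d i ^ ⌊m (B.vec i)⌋ := by
      intro i hi
      by_cases h : c i = 0
      · have : m (B.vec i) = 0 := by simpa [e, h] using hi
        simp [this]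
      · simp [d, h]
    rw [key 0 h0.1, key 1 h0.2]
  · rw [Chart.limitPoint_of_ne_zero _ _ hm h0]
    have key : ∀ i, (e i : ℝ) * m (B.vec i) ≠ 0 → c i ^ ⌊m (B.vec i)⌋ = 0 := by
      intro i hi
      have h : c i = 0 := by
        by_contra h
        simp [e, h] at hi
      rw [h]
      refine zero_zpow _ fun h' => right_ne_zero_of_mul hi ?_
      rw [← floor_cast hm (B.vec_mem i), h', Int.cast_zero]
    rw [hmv] at h0
    by_cases h1 : (e 0 : ℝ) * m (B.vec 0) = 0
    · rw [key 1 (fun h2 => h0 (by rw [h1, h2, add_zero])), mul_zero]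
    · rw [key 0 h1, zero_mul]

theorem Fan.Smooth.exists_eq_limitPoint {Δ : Fan N} (hΔ : Δ.Smooth) (p : Δ.Surface) :
    ∃ (σ : Cone) (hσ : σ ∈ Δ.cones) (v : Plane) (_ : v ∈ N) (hv : v ∈ σ) (t : Torus N),
      p = Δ.chartEmb hσ (Chart.limitPoint σ hv t) := by
  obtain ⟨σ, hσ, u, rfl⟩ := Δ.exists_chartEmb p
  obtain ⟨B, I, rfl⟩ := hΔ σ hσ
  obtain ⟨v, hvN, hv, t, rfl⟩ := B.exists_eq_limitPoint u
  exact ⟨_, hσ, v, hvN, hv, t, rfl⟩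

/-! ### Characters as maps to the Riemann sphere. -/

/-- The inverse stereographic projection of a complex number `z`. -/
noncomputable def stereo (z : ℂ) : ℂ × ℝ :=
  ((1 + ‖z‖ ^ 2)⁻¹ • z, (1 + ‖z‖ ^ 2)⁻¹)

/-- The inverse stereographic projection of the point `1 / z` of the Riemann sphere. -/
noncomputable def stereoInv (z : ℂ) : ℂ × ℝ :=
  ((1 + ‖z‖ ^ 2)⁻¹ • (starRingEnd ℂ) z, ‖z‖ ^ 2 * (1 + ‖z‖ ^ 2)⁻¹)

theorem one_add_norm_sq_ne_zero (z : ℂ) : 1 + ‖z‖ ^ 2 ≠ 0 := by positivity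

theorem continuous_stereo : Continuous stereo := by
  have h : Continuous fun z : ℂ => (1 + ‖z‖ ^ 2)⁻¹ :=
    Continuous.inv₀ (by fun_prop) one_add_norm_sq_ne_zero
  exact (h.smul continuous_id).prodMk h

theorem continuous_stereoInv : Continuous stereoInv := by
  have h : Continuous fun z : ℂ => (1 + ‖z‖ ^ 2)⁻¹ :=
    Continuous.inv₀ (by fun_prop) one_add_norm_sq_ne_zero
  exact (h.smul Complex.continuous_conj).prodMk ((by fun_prop : Continuous fun z : ℂ => ‖z‖ ^ 2).mul h)

theorem stereo_injective : Function.Injective stereo := by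
  intro z w h
  have h2 : (1 + ‖z‖ ^ 2)⁻¹ = (1 + ‖w‖ ^ 2)⁻¹ := congrArg Prod.snd h
  have h1 : (1 + ‖z‖ ^ 2)⁻¹ • z = (1 + ‖w‖ ^ 2)⁻¹ • w := congrArg Prod.fst h
  rw [h2] at h1
  exact smul_right_injective ℂ (inv_ne_zero (one_add_norm_sq_ne_zero w)) h1

theorem stereo_zero : stereo 0 = (0, 1) := by simp [stereo]

theorem stereoInv_zero : stereoInv 0 = (0, 0) := by simp [stereoInv]

theorem stereo_ne (z : ℂ) : stereo z ≠ (0, 0) := fun h =>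
  inv_ne_zero (one_add_norm_sq_ne_zero z) (congrArg Prod.snd h)

theorem stereoInv_eq {z w : ℂ} (h : z * w = 1) : stereoInv w = stereo z := by
  have hz : z ≠ 0 := left_ne_zero_of_mul_eq_one h
  have hw : w = z⁻¹ := eq_inv_of_mul_eq_one_right h
  have hz' : ‖z‖ ≠ 0 := norm_ne_zero_iff.2 hz
  have hs : (1 + ‖z⁻¹‖ ^ 2)⁻¹ = ‖z‖ ^ 2 * (1 + ‖z‖ ^ 2)⁻¹ := by
    rw [norm_inv]
    have := one_add_norm_sq_ne_zero z
    field_simp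
    ring
  subst hw
  refine Prod.ext ?_ ?_
  · change (1 + ‖z⁻¹‖ ^ 2)⁻¹ • (starRingEnd ℂ) z⁻¹ = (1 + ‖z‖ ^ 2)⁻¹ • z
    rw [hs, mul_comm, mul_smul]
    congr 1
    rw [Complex.real_smul, ← Complex.normSq_eq_norm_sq, Complex.normSq_eq_conj_mul_self, map_inv₀]
    have : (starRingEnd ℂ) z ≠ 0 := (map_ne_zero _).2 hz
    field_simp
  · change ‖z⁻¹‖ ^ 2 * (1 + ‖z⁻¹‖ ^ 2)⁻¹ = (1 + ‖z‖ ^ 2)⁻¹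
    rw [hs, norm_inv]
    field_simp

open Classical in
/-- The value in the Riemann sphere of the character `m` at a point of `U_σ`, provided that `m` or
`-m` is non-negative on `σ`. -/
noncomputable def Chart.sphereVal {σ : Cone} (m : Module.Dual ℝ Plane) (u : Chart N σ) : ℂ × ℝ :=
  if h : m ∈ semigroup N σ then stereo (u.1 ⟨m, h⟩)
  else if h : -m ∈ semigroup N σ then stereoInv (u.1 ⟨-m, h⟩) else 0

namespace Chart

variable {σ τ : Cone} {m : Module.Dual ℝ Plane}

theorem sphereVal_of_mem (hm : m ∈ semigroup N σ) (u : Chart N σ) :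
    u.sphereVal m = stereo (u.1 ⟨m, hm⟩) :=
  dif_pos hm

theorem sphereVal_of_neg_mem (hm : -m ∈ semigroup N σ) (u : Chart N σ) :
    u.sphereVal m = stereoInv (u.1 ⟨-m, hm⟩) := by
  by_cases h : m ∈ semigroup N σ
  · rw [sphereVal_of_mem h, stereoInv_eq (u.mul_neg_apply h hm)]
  · rw [sphereVal, dif_neg h, dif_pos hm]

theorem sphereVal_map (h : σ ≤ τ) (hm : m ∈ semigroup N τ ∨ -m ∈ semigroup N τ)
    (u : Chart N σ) : (u.map h).sphereVal m = u.sphereVal m := by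
  rcases hm with hm | hm
  · rw [sphereVal_of_mem hm, sphereVal_of_mem (semigroup_anti N h hm)]
    rfl
  · rw [sphereVal_of_neg_mem hm, sphereVal_of_neg_mem (semigroup_anti N h hm)]
    rfl

theorem continuous_sphereVal (hm : m ∈ semigroup N σ ∨ -m ∈ semigroup N σ) :
    Continuous fun u : Chart N σ => u.sphereVal m := by
  rcases hm with hm | hm
  · simp only [sphereVal_of_mem hm]
    exact continuous_stereo.comp (continuous_apply _)
  · simp only [sphereVal_of_neg_mem hm]
    exact continuous_stereoInv.comp (continuous_apply _)

theorem sphereVal_limitPoint_of_eq_zero (hm : m ∈ semigroup N σ ∨ -m ∈ semigroup N σ)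
    (hm' : m ∈ semigroup N ⊥) {v : Plane} (hv : v ∈ σ) (t : Torus N) (h : m v = 0) :
    (limitPoint σ hv t).sphereVal m = stereo (t.1 ⟨m, hm'⟩) := by
  rcases hm with hm | hm
  · rw [sphereVal_of_mem hm, limitPoint_of_eq_zero hv t hm h]
  · rw [sphereVal_of_neg_mem hm, limitPoint_of_eq_zero hv t hm (by simp [h])]
    exact stereoInv_eq (t.mul_neg_apply _ _)

theorem sphereVal_limitPoint_of_pos (hm : m ∈ semigroup N σ ∨ -m ∈ semigroup N σ) {v : Plane}
    (hv : v ∈ σ) (t : Torus N) (h : 0 < m v) : (limitPoint σ hv t).sphereVal m = (0, 1) := by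
  rcases hm with hm | hm
  · rw [sphereVal_of_mem hm, limitPoint_of_ne_zero hv t hm h.ne', stereo_zero]
  · have := hm.2 v hv
    rw [LinearMap.neg_apply] at this
    linarith

theorem sphereVal_limitPoint_of_neg (hm : m ∈ semigroup N σ ∨ -m ∈ semigroup N σ) {v : Plane}
    (hv : v ∈ σ) (t : Torus N) (h : m v < 0) : (limitPoint σ hv t).sphereVal m = (0, 0) := by
  rcases hm with hm | hm
  · have := hm.2 v hv
    linarith
  · rw [sphereVal_of_neg_mem hm, limitPoint_of_ne_zero hv t hm (by simpa using h.ne),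
      stereoInv_zero]

/-- The sphere-valued character `m` determines the sign of `m v` at a limit point in the direction
`v`, and the value of `m` at the torus point if `m v = 0`. -/
theorem eq_of_sphereVal_eq {σ' : Cone} (hm : m ∈ semigroup N σ ∨ -m ∈ semigroup N σ)
    (hm' : m ∈ semigroup N σ' ∨ -m ∈ semigroup N σ') (hmb : m ∈ semigroup N ⊥) {v v' : Plane}
    (hv : v ∈ σ) (hv' : v' ∈ σ') (t t' : Torus N)
    (h : (limitPoint σ hv t).sphereVal m = (limitPoint σ' hv' t').sphereVal m) :
    SignType.sign (m v) = SignType.sign (m v') ∧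
      (m v = 0 → t.1 ⟨m, hmb⟩ = t'.1 ⟨m, hmb⟩) := by
  have hne : ∀ s : Torus N, stereo (s.1 ⟨m, hmb⟩) ≠ (0, 1) := fun s h => by
    rw [← stereo_zero] at h
    exact s.torus_apply_ne_zero _ (stereo_injective h)
  have hne' : ∀ s : Torus N, stereo (s.1 ⟨m, hmb⟩) ≠ (0, 0) := fun s => stereo_ne _
  have h01 : ((0, 1) : ℂ × ℝ) ≠ (0, 0) := by simp
  rcases lt_trichotomy (m v) 0 with h1 | h1 | h1 <;>
    rcases lt_trichotomy (m v') 0 with h2 | h2 | h2 <;>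
    simp only [sphereVal_limitPoint_of_neg hm hv t, sphereVal_limitPoint_of_neg hm' hv' t',
      sphereVal_limitPoint_of_pos hm hv t, sphereVal_limitPoint_of_pos hm' hv' t',
      sphereVal_limitPoint_of_eq_zero hm hmb hv t,
      sphereVal_limitPoint_of_eq_zero hm' hmb hv' t', h1, h2] at h
  · exact ⟨by rw [sign_neg h1, sign_neg h2], fun h3 => absurd h3 h1.ne⟩
  · exact absurd h.symm (hne' t')
  · exact absurd h.symm h01
  · exact absurd h (hne' t)
  · exact ⟨by rw [h1, h2], fun _ => stereo_injective h⟩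
  · exact absurd h (hne t)
  · exact absurd h h01
  · exact absurd h.symm (hne t')
  · exact ⟨by rw [sign_pos h1, sign_pos h2], fun h3 => absurd h3 h1.ne'⟩

end Chart

namespace Fan

variable (Δ : Fan N) {m : Module.Dual ℝ Plane}

/-- The character `m` as a map of the toric surface to the Riemann sphere, for `m` of constant sign
on every cone. -/
noncomputable def sphereVal (hm : ∀ σ ∈ Δ.cones, m ∈ semigroup N σ ∨ -m ∈ semigroup N σ) :
    Δ.Surface → ℂ × ℝ :=
  Quot.lift (fun p => p.2.sphereVal m) (by
    rintro ⟨⟨σ, hσ⟩, u⟩ ⟨⟨τ, hτ⟩, u'⟩ ⟨w, hw, hw'⟩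
    dsimp only at hw hw' ⊢
    rw [← hw, ← hw', Chart.sphereVal_map _ (hm σ hσ), Chart.sphereVal_map _ (hm τ hτ)])

theorem continuous_sphereVal (hm : ∀ σ ∈ Δ.cones, m ∈ semigroup N σ ∨ -m ∈ semigroup N σ) :
    Continuous (Δ.sphereVal hm) :=
  continuous_quot_lift _
    (continuous_sigma fun σ : Δ.cones => Chart.continuous_sphereVal (hm σ.1 σ.2))

/-- The equation holds over the torus and is a closed condition, so it persists on the closure. -/
theorem sphereVal_of_mem_graph {φ : Plane →ₗ[ℝ] Plane} {hφ : ∀ n ∈ N, φ n ∈ N}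
    (hm : ∀ σ ∈ Δ.cones, m ∈ semigroup N σ ∨ -m ∈ semigroup N σ)
    (hmφ : ∀ σ ∈ Δ.cones, m ∘ₗ φ ∈ semigroup N σ ∨ -(m ∘ₗ φ) ∈ semigroup N σ)
    (hmb : m ∈ semigroup N ⊥) {p q : Δ.Surface} (h : (p, q) ∈ Δ.graph φ hφ) :
    Δ.sphereVal hmφ p = Δ.sphereVal hm q := by
  have hclosed : IsClosed {x : Δ.Surface × Δ.Surface | Δ.sphereVal hmφ x.1 = Δ.sphereVal hm x.2} :=
    isClosed_eq ((Δ.continuous_sphereVal hmφ).comp continuous_fst)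
      ((Δ.continuous_sphereVal hm).comp continuous_snd)
  refine closure_minimal ?_ hclosed h
  rintro _ ⟨t, rfl⟩
  have hmφb : m ∘ₗ φ ∈ semigroup N ⊥ := mem_semigroup_bot fun n hn => hmb.1 (φ n) (hφ n hn)
  change Chart.sphereVal (m ∘ₗ φ) t = Chart.sphereVal m (monomialMap φ hφ t)
  rw [Chart.sphereVal_of_mem hmφb, Chart.sphereVal_of_mem hmb]
  rfl

theorem algebraicallyStable_of_indeterminacy_eq_empty {φ : Plane →ₗ[ℝ] Plane}
    {hφ : ∀ n ∈ N, φ n ∈ N} (h : Δ.indeterminacy φ hφ = ∅) : Δ.AlgebraicallyStable φ hφ := by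
  have h0 : Δ.totalPreimage φ hφ ∅ = ∅ := by simp [totalPreimage]
  have : ∀ k, (Δ.totalPreimage φ hφ)^[k] ∅ = ∅ := fun k => Function.iterate_fixed h0 k
  rw [AlgebraicallyStable, h]
  simp [this]

end Fan

end Toric

/-! ### Part (ii): the lattice `2ℤ × ℤ` and the fan of four walls. -/

namespace Toric

/-- The lattice `2ℤ × ℤ`. -/
def coverLattice : Submodule ℤ Plane where
  carrier := {x | (∃ k : ℤ, x 0 = 2 * k) ∧ ∃ k : ℤ, x 1 = k}
  zero_mem' := ⟨⟨0, by simp⟩, ⟨0, by simp⟩⟩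
  add_mem' := by
    rintro x y ⟨⟨a, ha⟩, b, hb⟩ ⟨⟨c, hc⟩, d, hd⟩
    exact ⟨⟨a + c, by rw [Pi.add_apply, ha, hc]; push_cast; ring⟩,
      ⟨b + d, by rw [Pi.add_apply, hb, hd]; push_cast; ring⟩⟩
  smul_mem' := by
    rintro k x ⟨⟨a, ha⟩, b, hb⟩
    exact ⟨⟨k * a, by rw [Pi.smul_apply, ha, zsmul_eq_mul]; push_cast; ring⟩,
      ⟨k * b, by rw [Pi.smul_apply, hb, zsmul_eq_mul]; push_cast; ring⟩⟩

theorem mem_coverLattice (x : Plane) :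
    x ∈ coverLattice ↔ (∃ k : ℤ, x 0 = 2 * k) ∧ ∃ k : ℤ, x 1 = k :=
  Iff.rfl

theorem coverLattice_le : coverLattice ≤ stdLattice := by
  rintro x ⟨⟨k, hk⟩, l, hl⟩
  rw [mem_stdLattice_iff, Fin.forall_fin_two]
  exact ⟨⟨2 * k, by rw [hk]; push_cast; ring⟩, l, hl⟩

/-- The sublattice is the kernel of the first coordinate modulo 2. -/
theorem relIndex_coverLattice :
    coverLattice.toAddSubgroup.relIndex stdLattice.toAddSubgroup ≠ 0 := by
  have hfl : ∀ x ∈ stdLattice, ((⌊x 0⌋ : ℤ) : ℝ) = x 0 := fun x hx => by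
    obtain ⟨k, hk⟩ := (mem_stdLattice_iff x).1 hx 0
    rw [hk, Int.floor_intCast]
  let f : stdLattice.toAddSubgroup →+ ZMod 2 := AddMonoidHom.mk' (fun x => (⌊x.1 0⌋ : ℤ)) (by
    rintro ⟨x, hx⟩ ⟨y, hy⟩
    have : ⌊(x + y) 0⌋ = ⌊x 0⌋ + ⌊y 0⌋ := by
      rw [Pi.add_apply, ← hfl x hx, Int.floor_intCast_add, hfl x hx]
    change ((⌊(x + y) 0⌋ : ℤ) : ZMod 2) = (⌊x 0⌋ : ℤ) + (⌊y 0⌋ : ℤ)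
    rw [this]
    push_cast
    rfl)
  have hker : coverLattice.toAddSubgroup.addSubgroupOf stdLattice.toAddSubgroup = f.ker := by
    ext ⟨x, hx⟩
    rw [AddSubgroup.mem_addSubgroupOf, AddMonoidHom.mem_ker]
    change x ∈ coverLattice ↔ ((⌊x 0⌋ : ℤ) : ZMod 2) = 0
    rw [mem_coverLattice, ZMod.intCast_zmod_eq_zero_iff_dvd]
    constructor
    · rintro ⟨⟨k, hk⟩, -⟩
      refine ⟨k, ?_⟩
      have := hfl x hx
      rw [hk] at this ⊢
      exact_mod_cast this
    · rintro ⟨k, hk⟩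
      refine ⟨⟨k, ?_⟩, (mem_stdLattice_iff x).1 hx 1⟩
      rw [← hfl x hx, hk]
      push_cast
      rfl
  rw [AddSubgroup.relIndex, hker, AddSubgroup.index_ker]
  exact Nat.card_pos.ne'

theorem matrixMap_mem_coverLattice :
    ∀ n ∈ coverLattice, matrixMap !![0, -8; 1, 4] n ∈ coverLattice := by
  rintro x ⟨⟨k, hk⟩, l, hl⟩
  rw [matrixMap_apply, mem_coverLattice]
  simp only [Matrix.cons_val_zero, Matrix.cons_val_one, hk, hl]
  exact ⟨⟨-4 * l, by push_cast; ring⟩, 2 * k + 4 * l, by push_cast; ring⟩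

/-- The basis `(2a, b), (2c, d)` of the lattice `2ℤ × ℤ`. -/
noncomputable def coverBasis (a b c d : ℤ) (h : a * d - b * c = 1) :
    LatticeBasis coverLattice where
  vec := ![![2 * a, b], ![2 * c, d]]
  coord := ![((d : ℝ) / 2) • LinearMap.proj 0 - (c : ℝ) • LinearMap.proj 1,
    (a : ℝ) • LinearMap.proj 1 - ((b : ℝ) / 2) • LinearMap.proj 0]
  vec_mem := by
    rw [Fin.forall_fin_two]
    exact ⟨⟨⟨a, rfl⟩, b, rfl⟩, ⟨⟨c, rfl⟩, d, rfl⟩⟩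
  coord_int := by
    rw [Fin.forall_fin_two]
    constructor
    · rintro x ⟨⟨k, hk⟩, l, hl⟩
      refine ⟨d * k - c * l, ?_⟩
      simp [hk, hl]
      ring
    · rintro x ⟨⟨k, hk⟩, l, hl⟩
      refine ⟨a * l - b * k, ?_⟩
      simp [hk, hl]
      ring
  coord_vec := by
    have h' : (a : ℝ) * d - b * c = 1 := by exact_mod_cast h
    simp only [Fin.forall_fin_two]
    refine ⟨⟨?_, ?_⟩, ?_, ?_⟩ <;> simp <;> linarith
  sum_coord x := by
    have h' : (a : ℝ) * d - b * c = 1 := by exact_mod_cast h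
    ext i
    fin_cases i
    · simp
      linear_combination (x 0) * h'
    · simp
      linear_combination (x 1) * h'

/-- The linear forms `x / 2`, `y`, `x / 2 + y`, `x / 2 + 2 y`, whose zero sets are the walls of
the fan. -/
noncomputable def wallForm : Fin 4 → Module.Dual ℝ Plane :=
  ![(1 / 2 : ℝ) • LinearMap.proj 0, LinearMap.proj 1,
    (1 / 2 : ℝ) • LinearMap.proj 0 + LinearMap.proj 1,
    (1 / 2 : ℝ) • LinearMap.proj 0 + (2 : ℝ) • LinearMap.proj 1]

theorem wallForm_integral (j : Fin 4) : ∀ n ∈ coverLattice, ∃ k : ℤ, wallForm j n = k := by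
  rintro x ⟨⟨k, hk⟩, l, hl⟩
  fin_cases j
  · exact ⟨k, by simp [wallForm, hk]⟩
  · exact ⟨l, by simp [wallForm, hl]⟩
  · exact ⟨k + l, by simp [wallForm, hk, hl]⟩
  · exact ⟨k + 2 * l, by simp [wallForm, hk, hl]⟩

/-- This is the invariance of the arrangement: `φ` permutes the four walls cyclically. -/
theorem wallForm_comp (j : Fin 4) :
    wallForm j ∘ₗ matrixMap !![0, -8; 1, 4] =
      (![-4, 2, 2, 4] : Fin 4 → ℤ) j • wallForm ((![1, 3, 0, 2] : Fin 4 → Fin 4) j) := by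
  refine LinearMap.ext fun x => ?_
  rw [LinearMap.comp_apply, matrixMap_apply, ← Int.cast_smul_eq_zsmul ℝ]
  fin_cases j <;> simp [wallForm] <;> ring

theorem eq_zero_of_wallForm {x : Plane} (h : ∀ j, wallForm j x = 0) : x = 0 := by
  have h0 := h 0
  have h1 := h 1
  simp [wallForm] at h0 h1
  ext i
  fin_cases i
  · exact h0
  · exact h1

/-- The basis spans a chamber of the arrangement of the walls. -/
def IsChamber (B : LatticeBasis coverLattice) : Prop :=
  (∀ i, ∃ j, B.coord i = wallForm j ∨ B.coord i = -wallForm j) ∧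
    ∀ j, (∀ i, 0 ≤ wallForm j (B.vec i)) ∨ ∀ i, wallForm j (B.vec i) ≤ 0

/-- Reduces a chamber to arithmetic: `h0` and `h1` identify the dual basis with signed wall forms,
and `hs`, listing the walls by their coefficients in `x / 2` and `y`, says that no wall separates
the generators. -/
theorem exists_chamber_of_coverBasis {x : Plane} (a b c d : ℤ) (i j : Fin 4) (e f : ℤ)
    (h : a * d - b * c = 1) (he : e = 1 ∨ e = -1) (hf : f = 1 ∨ f = -1)
    (h0 : ∀ y : Plane, (d : ℝ) / 2 * y 0 - c * y 1 = e * wallForm i y)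
    (h1 : ∀ y : Plane, (a : ℝ) * y 1 - b / 2 * y 0 = f * wallForm j y)
    (hs : ∀ u ∈ [((1 : ℤ), (0 : ℤ)), (0, 1), (1, 1), (1, 2)],
      (0 ≤ u.1 * a + u.2 * b ∧ 0 ≤ u.1 * c + u.2 * d) ∨
        (u.1 * a + u.2 * b ≤ 0 ∧ u.1 * c + u.2 * d ≤ 0))
    (hx0 : 0 ≤ e * wallForm i x) (hx1 : 0 ≤ f * wallForm j x) :
    ∃ B : LatticeBasis coverLattice, IsChamber B ∧ ∀ i, 0 ≤ B.coord i x := by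
  have h0' : (coverBasis a b c d h).coord 0 = e • wallForm i := by
    rw [← Int.cast_smul_eq_zsmul ℝ]
    exact LinearMap.ext h0
  have h1' : (coverBasis a b c d h).coord 1 = f • wallForm j := by
    rw [← Int.cast_smul_eq_zsmul ℝ]
    exact LinearMap.ext h1
  refine ⟨coverBasis a b c d h, ⟨?_, ?_⟩, ?_⟩
  · rw [Fin.forall_fin_two, h0', h1']
    refine ⟨⟨i, ?_⟩, j, ?_⟩
    · rcases he with rfl | rfl <;> simp
    · rcases hf with rfl | rfl <;> simp
  · have hval : ∀ (j : Fin 4) (p q : ℤ), wallForm j ![2 * (p : ℝ), (q : ℝ)] =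
        (((![(1, 0), (0, 1), (1, 1), (1, 2)] : Fin 4 → ℤ × ℤ) j).1 * p +
          ((![(1, 0), (0, 1), (1, 1), (1, 2)] : Fin 4 → ℤ × ℤ) j).2 * q : ℤ) := by
      intro j p q
      fin_cases j <;> simp [wallForm]
    intro j
    simp only [Fin.forall_fin_two, coverBasis, Matrix.cons_val_zero, Matrix.cons_val_one, hval,
      Int.cast_nonneg_iff, Int.cast_nonpos]
    exact hs _ (by fin_cases j <;> simp)
  · rw [Fin.forall_fin_two, h0', h1', ← Int.cast_smul_eq_zsmul ℝ, ← Int.cast_smul_eq_zsmul ℝ]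
    exact ⟨hx0, hx1⟩

/-- There are eight chambers. The arguments are the generators `(2a, b)` and `(2c, d)`, the two
bounding walls, and the signs that make them the coordinate forms. -/
theorem exists_chamber (x : Plane) :
    ∃ B : LatticeBasis coverLattice, IsChamber B ∧ ∀ i, 0 ≤ B.coord i x := by
  rcases le_total 0 (x 0 / 2) with g0 | g0 <;> rcases le_total 0 (x 1) with g1 | g1
  · refine exists_chamber_of_coverBasis 1 0 0 1 0 1 1 1 ?_ ?_ ?_ ?_ ?_ ?_ ?_ ?_ <;>
      simp [wallForm] <;> linarith
  · rcases le_total (x 0 / 2 + x 1) 0 with g2 | g2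
    · refine exists_chamber_of_coverBasis 0 (-1) 1 (-1) 2 0 (-1) 1 ?_ ?_ ?_ ?_ ?_ ?_ ?_ ?_ <;>
        simp [wallForm] <;> intros <;> linarith
    rcases le_total (x 0 / 2 + 2 * x 1) 0 with g3 | g3
    · refine exists_chamber_of_coverBasis 1 (-1) 2 (-1) 3 2 (-1) 1 ?_ ?_ ?_ ?_ ?_ ?_ ?_ ?_ <;>
        simp [wallForm] <;> intros <;> linarith
    · refine exists_chamber_of_coverBasis 2 (-1) 1 0 1 3 (-1) 1 ?_ ?_ ?_ ?_ ?_ ?_ ?_ ?_ <;>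
        simp [wallForm] <;> intros <;> linarith
  · rcases le_total 0 (x 0 / 2 + x 1) with g2 | g2
    · refine exists_chamber_of_coverBasis 0 1 (-1) 1 2 0 1 (-1) ?_ ?_ ?_ ?_ ?_ ?_ ?_ ?_ <;>
        simp [wallForm] <;> linarith
    rcases le_total 0 (x 0 / 2 + 2 * x 1) with g3 | g3
    · refine exists_chamber_of_coverBasis (-1) 1 (-2) 1 3 2 1 (-1) ?_ ?_ ?_ ?_ ?_ ?_ ?_ ?_ <;>
        simp [wallForm] <;> intros <;> linarith
    · refine exists_chamber_of_coverBasis (-2) 1 (-1) 0 1 3 1 (-1) ?_ ?_ ?_ ?_ ?_ ?_ ?_ ?_ <;>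
        simp [wallForm] <;> intros <;> linarith
  · refine exists_chamber_of_coverBasis (-1) 0 0 (-1) 0 1 (-1) (-1) ?_ ?_ ?_ ?_ ?_ ?_ ?_ ?_ <;>
      simp [wallForm] <;> intros <;> linarith

/-- The cone of all `y` at which each wall form has the same sign as at `x`, or vanishes. -/
def wallCone (x : Plane) : Cone where
  carrier := {y | ∀ j, 0 ≤ wallForm j x * wallForm j y ∧ (wallForm j x = 0 → wallForm j y = 0)}
  zero_mem' := by simp
  add_mem' := by
    intro y z hy hz j
    rw [map_add, mul_add]
    exact ⟨add_nonneg (hy j).1 (hz j).1, fun h => by rw [(hy j).2 h, (hz j).2 h, add_zero]⟩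
  smul_mem' := by
    intro a y hy j
    have : wallForm j (a • y) = a.1 * wallForm j y := (wallForm j).map_smul a.1 y
    rw [this, mul_left_comm]
    exact ⟨mul_nonneg a.2 (hy j).1, fun h => by rw [(hy j).2 h, mul_zero]⟩

theorem mem_wallCone {x y : Plane} : y ∈ wallCone x ↔
    ∀ j, 0 ≤ wallForm j x * wallForm j y ∧ (wallForm j x = 0 → wallForm j y = 0) :=
  Iff.rfl

theorem self_mem_wallCone (x : Plane) : x ∈ wallCone x :=
  fun _ => ⟨mul_self_nonneg _, id⟩

theorem wallCone_congr {x x' : Plane}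
    (h : ∀ j, SignType.sign (wallForm j x) = SignType.sign (wallForm j x')) :
    wallCone x = wallCone x' := by
  ext y
  rw [mem_wallCone, mem_wallCone]
  refine forall_congr' fun j => ?_
  have hj := h j
  rcases lt_trichotomy (wallForm j x) 0 with h1 | h1 | h1
  · rw [sign_neg h1] at hj
    have h2 := sign_eq_neg_one_iff.1 hj.symm
    have key : ∀ a : ℝ, a < 0 → (0 ≤ a * wallForm j y ↔ wallForm j y ≤ 0) := fun a ha =>
      ⟨fun h => nonpos_of_mul_nonneg_right h ha, mul_nonneg_of_nonpos_of_nonpos ha.le⟩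
    rw [key _ h1, key _ h2]
    simp [h1.ne, h2.ne]
  · rw [h1, sign_zero] at hj
    rw [h1, sign_eq_zero_iff.1 hj.symm]
  · rw [sign_pos h1] at hj
    have h2 := sign_eq_one_iff.1 hj.symm
    simp [h1.ne', h2.ne', h1, h2]

theorem wallCone_mono {x y : Plane} (h : y ∈ wallCone x) : wallCone y ≤ wallCone x := by
  intro z hz j
  obtain ⟨h1, h2⟩ := h j
  obtain ⟨h3, h4⟩ := hz j
  refine ⟨?_, fun h0 => h4 (h2 h0)⟩
  rcases lt_trichotomy (wallForm j y) 0 with h5 | h5 | h5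
  · exact mul_nonneg_of_nonpos_of_nonpos (nonpos_of_mul_nonneg_left h1 h5)
      (nonpos_of_mul_nonneg_right h3 h5)
  · rw [h4 h5, mul_zero]
  · exact mul_nonneg (nonneg_of_mul_nonneg_left h1 h5) (nonneg_of_mul_nonneg_right h3 h5)

/-- The coordinate forms are themselves signed walls, which bounds the cone from outside. Conversely
no wall separates the generators, so each one with positive coefficient in `x` has signs compatible
with `x`. -/
theorem IsChamber.wallCone_eq {B : LatticeBasis coverLattice} (hB : IsChamber B) {x : Plane}
    (hx : ∀ i, 0 ≤ B.coord i x) :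
    wallCone x = PointedCone.hull ℝ (B.vec '' {i | 0 < B.coord i x}) := by
  refine le_antisymm (fun y hy => ?_) (Submodule.span_le.2 ?_)
  · rw [B.mem_hull_iff]
    intro i
    have key : 0 ≤ B.coord i x * B.coord i y ∧ (B.coord i x = 0 → B.coord i y = 0) := by
      obtain ⟨j, hj | hj⟩ := hB.1 i
      · rw [hj]
        exact hy j
      · rw [hj]
        simpa using hy j
    rcases (hx i).eq_or_lt with h | h
    · rw [key.2 h.symm]
      simp
    · exact ⟨nonneg_of_mul_nonneg_right key.1 h, fun h' => absurd h h'⟩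
  · rintro _ ⟨i, hi, rfl⟩ j
    have hi' : 0 < B.coord i x := hi
    have hsum : wallForm j x = ∑ k, B.coord k x * wallForm j (B.vec k) := by
      rw [Fin.sum_univ_two, ← B.apply_eq]
    rcases hB.2 j with h | h
    · have hnn : ∀ k ∈ Finset.univ, 0 ≤ B.coord k x * wallForm j (B.vec k) := fun k _ =>
        mul_nonneg (hx k) (h k)
      rw [hsum]
      refine ⟨mul_nonneg (Finset.sum_nonneg hnn) (h i), fun h0 => ?_⟩
      exact (mul_eq_zero.1 ((Finset.sum_eq_zero_iff_of_nonneg hnn).1 h0 i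
        (Finset.mem_univ i))).resolve_left hi'.ne'
    · have hnp : ∀ k ∈ Finset.univ, B.coord k x * wallForm j (B.vec k) ≤ 0 := fun k _ =>
        mul_nonpos_of_nonneg_of_nonpos (hx k) (h k)
      rw [hsum]
      refine ⟨mul_nonneg_of_nonpos_of_nonpos (Finset.sum_nonpos hnp) (h i), fun h0 => ?_⟩
      exact (mul_eq_zero.1 ((Finset.sum_eq_zero_iff_of_nonpos hnp).1 h0 i
        (Finset.mem_univ i))).resolve_left hi'.ne'

theorem exists_wallCone_eq (x : Plane) : ∃ (B : LatticeBasis coverLattice) (I : Set (Fin 2)),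
    IsChamber B ∧ wallCone x = PointedCone.hull ℝ (B.vec '' I) := by
  obtain ⟨B, hB, hx⟩ := exists_chamber x
  exact ⟨B, _, hB, hB.wallCone_eq hx⟩

theorem IsChamber.hull_eq {B : LatticeBasis coverLattice} (hB : IsChamber B) (I : Set (Fin 2)) :
    ∃ x, wallCone x = PointedCone.hull ℝ (B.vec '' I) := by
  classical
  have hcoord : ∀ i, B.coord i (∑ k, (if k ∈ I then (1 : ℝ) else 0) • B.vec k) =
      if i ∈ I then 1 else 0 := fun i => by
    simp only [map_sum, map_smul, B.coord_vec, smul_eq_mul, mul_ite, mul_one, mul_zero,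
      Finset.sum_ite_eq, Finset.mem_univ, if_true]
  refine ⟨∑ k, (if k ∈ I then (1 : ℝ) else 0) • B.vec k, ?_⟩
  rw [hB.wallCone_eq fun i => by rw [hcoord]; split_ifs <;> simp]
  congr 2
  ext i
  rw [Set.mem_ofPred_eq, hcoord]
  split_ifs with h <;> simp [h]

/-- The fan in `2ℤ × ℤ` cut out by the four walls. -/
noncomputable def wallFan : Fan coverLattice where
  cones := Set.range wallCone
  finite := by
    classical
    let S : Plane → Fin 4 → SignType := fun x j => SignType.sign (wallForm j x)
    let g : (Fin 4 → SignType) → Cone := fun s => if h : ∃ x, S x = s then wallCone h.choose else ⊥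
    refine (Set.finite_range g).subset ?_
    rintro _ ⟨x, rfl⟩
    have h : ∃ y, S y = S x := ⟨x, rfl⟩
    refine ⟨S x, ?_⟩
    dsimp only [g]
    rw [dif_pos h]
    exact wallCone_congr (congrFun h.choose_spec)
  zero_mem := ⟨0, by
    refine le_bot_iff.1 fun y hy => ?_
    exact (Submodule.mem_bot _).2 (eq_zero_of_wallForm fun j => (hy j).2 (map_zero _))⟩
  rational := by
    rintro _ ⟨x, rfl⟩
    obtain ⟨B, I, -, h⟩ := exists_wallCone_eq x
    refine ⟨(Set.toFinite (B.vec '' I)).toFinset, ?_, by rw [h, Set.Finite.coe_toFinset]⟩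
    intro v hv
    obtain ⟨i, -, rfl⟩ := (Set.Finite.mem_toFinset _).1 hv
    exact B.vec_mem i
  strict := by
    rintro _ ⟨x, rfl⟩ y hy hy'
    refine eq_zero_of_wallForm fun j => ?_
    obtain ⟨h1, h2⟩ := hy j
    have h3 := (hy' j).1
    rw [map_neg, mul_neg] at h3
    have h4 : wallForm j x * wallForm j y = 0 := by linarith
    rcases mul_eq_zero.1 h4 with h | h
    · exact h2 h
    · exact h
  face_mem := by
    rintro _ ⟨x, rfl⟩ τ hτ
    obtain ⟨B, I, hB, h⟩ := exists_wallCone_eq x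
    rw [h] at hτ
    rw [B.face_eq hτ]
    exact hB.hull_eq _
  inter_face := by
    rintro _ ⟨x, rfl⟩ _ ⟨y, rfl⟩
    refine ⟨inf_le_left, ?_⟩
    intro u w a hu hw ha huw
    refine ⟨hu, fun j => ?_⟩
    obtain ⟨h1, h2⟩ := hu j
    obtain ⟨h3, h4⟩ := hw j
    obtain ⟨h5, h6⟩ := huw.2 j
    rw [map_add, map_smul, smul_eq_mul] at h5 h6
    -- On `wallCone x` a wall form never changes sign, so `w` cannot cancel the contribution of `u`.
    have key : wallForm j u = 0 ∨ 0 < wallForm j u * (a * wallForm j u + wallForm j w) := by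
      by_cases hu0 : wallForm j u = 0
      · exact Or.inl hu0
      · have hx0 : wallForm j x ≠ 0 := fun h => hu0 (h2 h)
        have huw0 : 0 ≤ wallForm j u * wallForm j w := by
          refine nonneg_of_mul_nonneg_right (a := wallForm j x ^ 2) ?_ (by positivity)
          have := mul_nonneg h1 h3
          linarith
        right
        have : 0 < a * (wallForm j u * wallForm j u) := mul_pos ha (mul_self_pos.2 hu0)
        linarith
    rcases key with h0 | h0
    · simp [h0]
    · have hs0 := right_ne_zero_of_mul h0.ne'
      refine ⟨?_, fun h => absurd (h6 h) hs0⟩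
      refine nonneg_of_mul_nonneg_right (a := (a * wallForm j u + wallForm j w) ^ 2) ?_
        (by positivity)
      have := mul_nonneg h5 h0.le
      linarith

theorem wallFan_smooth : wallFan.Smooth := by
  rintro _ ⟨x, rfl⟩
  obtain ⟨B, I, -, h⟩ := exists_wallCone_eq x
  exact ⟨B, I, h⟩

theorem Fan.Smooth.isRegular {N : Submodule ℤ Plane} {Δ : Fan N} (hΔ : Δ.Smooth) :
    Δ.IsRegular := by
  intro σ hσ
  obtain ⟨B, I, h⟩ := hΔ σ hσ
  obtain ⟨b, hb⟩ := B.exists_basis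
  exact ⟨b, I, by rw [h]; congr 2; ext i; rw [hb]⟩

theorem wallFan_refines : wallFan.Refines fanP1xP1 := by
  constructor
  · rw [support_fanP1xP1]
    exact Set.eq_univ_of_forall fun x => ⟨_, ⟨x, rfl⟩, self_mem_wallCone x⟩
  · rintro _ ⟨x, rfl⟩
    refine ⟨_, ⟨fun i => SignType.sign (x i), rfl⟩, fun y hy => ?_⟩
    rw [mem_signCone]
    have h0 := hy 0
    have h1 := hy 1
    -- The coordinate axes are among the walls: the first two forms are `x / 2` and `y`.
    have key : ∀ i, 0 ≤ x i * y i ∧ (x i = 0 → y i = 0) := by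
      rw [Fin.forall_fin_two]
      simp [wallForm] at h0 h1
      exact ⟨⟨by linarith, h0.2⟩, h1⟩
    intro i
    obtain ⟨h2, h3⟩ := key i
    refine ⟨|y i|, abs_nonneg _, ?_⟩
    rcases lt_trichotomy (x i) 0 with h | h | h
    · rw [sign_neg h, abs_of_nonpos (nonpos_of_mul_nonneg_right h2 h)]
      simp
    · rw [h, h3 h]
      simp
    · rw [sign_pos h, abs_of_nonneg (nonneg_of_mul_nonneg_right h2 h)]
      simp

theorem zsmul_wallForm_mem (j : Fin 4) (c : ℤ) :
    ∀ σ ∈ wallFan.cones, c • wallForm j ∈ semigroup coverLattice σ ∨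
      -(c • wallForm j) ∈ semigroup coverLattice σ := by
  rintro _ ⟨x, rfl⟩
  have hint : ∀ n ∈ coverLattice, ∃ k : ℤ, (c • wallForm j) n = k := fun n hn => by
    obtain ⟨k, hk⟩ := wallForm_integral j n hn
    exact ⟨c * k, by rw [LinearMap.smul_apply, hk, zsmul_eq_mul, Int.cast_mul]⟩
  have hval : ∀ y, (c • wallForm j) y = c * wallForm j y := fun y => by
    rw [LinearMap.smul_apply, zsmul_eq_mul]
  have key : (∀ y ∈ wallCone x, 0 ≤ wallForm j y) ∨ ∀ y ∈ wallCone x, wallForm j y ≤ 0 := by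
    rcases lt_trichotomy (wallForm j x) 0 with h | h | h
    · exact Or.inr fun y hy => nonpos_of_mul_nonneg_right (hy j).1 h
    · exact Or.inr fun y hy => ((hy j).2 h).le
    · exact Or.inl fun y hy => nonneg_of_mul_nonneg_right (hy j).1 h
  have key' : (∀ y ∈ wallCone x, 0 ≤ (c • wallForm j) y) ∨
      ∀ y ∈ wallCone x, 0 ≤ (-(c • wallForm j)) y := by
    simp only [LinearMap.neg_apply, hval, Left.nonneg_neg_iff]
    rcases le_total 0 c with hc | hc <;> rcases key with h | h
    · exact Or.inl fun y hy => mul_nonneg (by exact_mod_cast hc) (h y hy)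
    · exact Or.inr fun y hy => mul_nonpos_of_nonneg_of_nonpos (by exact_mod_cast hc) (h y hy)
    · exact Or.inr fun y hy => mul_nonpos_of_nonpos_of_nonneg (by exact_mod_cast hc) (h y hy)
    · exact Or.inl fun y hy =>
        mul_nonneg_of_nonpos_of_nonpos (by exact_mod_cast hc) (h y hy)
  exact key'.imp (fun h => ⟨hint, h⟩) fun h => ⟨neg_integral hint, h⟩

theorem wallForm_mem (j : Fin 4) :
    ∀ σ ∈ wallFan.cones, wallForm j ∈ semigroup coverLattice σ ∨
      -wallForm j ∈ semigroup coverLattice σ := by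
  simpa using zsmul_wallForm_mem j 1

/-- The signs of the four forms recover the cone containing the direction in its relative interior,
and the values of those vanishing there recover the point on its torus orbit. -/
theorem wallFan_ext {p q : wallFan.Surface}
    (h : ∀ j, wallFan.sphereVal (wallForm_mem j) p = wallFan.sphereVal (wallForm_mem j) q) :
    p = q := by
  obtain ⟨_, ⟨x, rfl⟩, v, hvN, hv, t, rfl⟩ := wallFan_smooth.exists_eq_limitPoint p
  obtain ⟨_, ⟨x', rfl⟩, v', hvN', hv', t', rfl⟩ := wallFan_smooth.exists_eq_limitPoint q
  have hb : ∀ j, wallForm j ∈ semigroup coverLattice ⊥ := fun j =>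
    mem_semigroup_bot (wallForm_integral j)
  have key := fun j => Chart.eq_of_sphereVal_eq (wallForm_mem j _ ⟨x, rfl⟩)
    (wallForm_mem j _ ⟨x', rfl⟩) (hb j) hv hv' t t' (h j)
  have hcone := wallCone_congr fun j => (key j).1
  have hv'v : v' ∈ wallCone v := by
    rw [hcone]
    exact self_mem_wallCone v'
  -- Both points are moved to the chart of the smallest cone `wallCone v`, where they can be
  -- compared.
  have h1 := wallFan.chartEmb_map ⟨v, rfl⟩ ⟨x, rfl⟩ (wallCone_mono hv)
    (Chart.limitPoint _ (self_mem_wallCone v) t)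
  have h2 := wallFan.chartEmb_map ⟨v, rfl⟩ ⟨x', rfl⟩ (hcone ▸ wallCone_mono hv')
    (Chart.limitPoint _ hv'v t')
  rw [Chart.map_limitPoint] at h1 h2
  rw [h1, h2]
  congr 1
  obtain ⟨B, hB, hBv⟩ := exists_chamber v
  have hBcone := hB.wallCone_eq hBv
  refine Subtype.ext (funext ?_)
  rintro ⟨m, hm⟩
  have hsign : ∀ i, SignType.sign (B.coord i v) = SignType.sign (B.coord i v') := fun i => by
    obtain ⟨j, hj | hj⟩ := hB.1 i <;> simp [hj, (key j).1, Left.sign_neg]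
  have hBv' : ∀ i, 0 ≤ B.coord i v' := fun i => by
    rw [← sign_nonneg_iff, ← hsign, sign_nonneg_iff]
    exact hBv i
  have hzero : ∀ i, B.coord i v' = 0 ↔ B.coord i v = 0 := fun i => by
    rw [← sign_eq_zero_iff, ← hsign, sign_eq_zero_iff]
  have hmi : ∀ i, B.coord i v ≠ 0 → 0 ≤ m (B.vec i) := fun i h => by
    refine hm.2 _ ?_
    rw [hBcone]
    exact B.vec_mem_hull (lt_of_le_of_ne (hBv i) (Ne.symm h))
  have hmv : ∀ w, (∀ i, 0 ≤ B.coord i w) → (∀ i, B.coord i w = 0 ↔ B.coord i v = 0) →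
      (m w = 0 ↔ ∀ i, B.coord i v = 0 ∨ m (B.vec i) = 0) := by
    intro w hw hw0
    have hterm : ∀ i, 0 ≤ B.coord i w * m (B.vec i) := fun i => by
      by_cases h : B.coord i v = 0
      · rw [(hw0 i).2 h, zero_mul]
      · exact mul_nonneg (hw i) (hmi i h)
    rw [B.apply_eq m w, add_eq_zero_iff_of_nonneg (hterm 0) (hterm 1), Fin.forall_fin_two,
      mul_eq_zero, mul_eq_zero, hw0, hw0]
  have hv1 := hmv v hBv fun _ => Iff.rfl
  have hv2 := hmv v' hBv' hzero
  by_cases h0 : m v = 0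
  · rw [Chart.limitPoint_of_eq_zero _ _ hm h0,
      Chart.limitPoint_of_eq_zero _ _ hm (hv2.2 (hv1.1 h0))]
    have hcb : ∀ i, B.coord i ∈ semigroup coverLattice ⊥ := fun i =>
      mem_semigroup_bot (B.coord_int i)
    have htt : ∀ i, B.coord i v = 0 → t.1 ⟨_, hcb i⟩ = t'.1 ⟨_, hcb i⟩ := by
      intro i hi
      obtain ⟨j, hj | hj⟩ := hB.1 i
      · simp only [hj]
        exact (key j).2 (by rw [← hj, hi])
      · have hnb : -wallForm j ∈ semigroup coverLattice ⊥ := hj ▸ hcb i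
        have h1 := (key j).2 (by simpa [hj] using hi)
        have h2 := t.mul_neg_apply (hb j) hnb
        have h3 := t'.mul_neg_apply (hb j) hnb
        simp only [hj]
        rw [← h1] at h3
        exact mul_left_cancel₀ (t.torus_apply_ne_zero _) (h2.trans h3.symm)
    -- Either coordinate `i` vanishes at `v`, where `t` and `t'` agree, or the exponent is 0.
    have hpow : ∀ i, t.1 ⟨_, hcb i⟩ ^ ⌊m (B.vec i)⌋ = t'.1 ⟨_, hcb i⟩ ^ ⌊m (B.vec i)⌋ := by
      intro i
      rcases hv1.1 h0 i with h | h
      · rw [htt i h]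
      · simp [h]
    have hmb := semigroup_anti coverLattice bot_le hm
    rw [B.torus_apply t hmb hcb, B.torus_apply t' hmb hcb, hpow, hpow]
  · rw [Chart.limitPoint_of_ne_zero _ _ hm h0,
      Chart.limitPoint_of_ne_zero _ _ hm fun h => h0 (hv1.2 (hv2.1 h))]

theorem wallFan_algebraicallyStable :
    wallFan.AlgebraicallyStable (matrixMap !![0, -8; 1, 4]) matrixMap_mem_coverLattice := by
  refine wallFan.algebraicallyStable_of_indeterminacy_eq_empty
    (Set.eq_empty_of_forall_notMem fun p hp => hp ?_)
  obtain ⟨_, ⟨x, rfl⟩, v, hvN, hv, t, rfl⟩ := wallFan_smooth.exists_eq_limitPoint p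
  -- An image exists since `φ v` lies in `wallCone (φ v)`. Its uniqueness comes from the four
  -- sphere-valued characters.
  have hg := wallFan.limitPoint_mem_graph (matrixMap !![0, -8; 1, 4]) matrixMap_mem_coverLattice
    ⟨x, rfl⟩ ⟨_, rfl⟩ hvN hv (self_mem_wallCone _) t
  refine ⟨_, hg, fun q hq => wallFan_ext fun j => ?_⟩
  have hmφ : ∀ σ ∈ wallFan.cones,
      wallForm j ∘ₗ matrixMap !![0, -8; 1, 4] ∈ semigroup coverLattice σ ∨
        -(wallForm j ∘ₗ matrixMap !![0, -8; 1, 4]) ∈ semigroup coverLattice σ := by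
    rw [wallForm_comp]
    exact zsmul_wallForm_mem _ _
  have hb := mem_semigroup_bot (wallForm_integral j)
  rw [← wallFan.sphereVal_of_mem_graph (wallForm_mem j) hmφ hb hq,
    wallFan.sphereVal_of_mem_graph (wallForm_mem j) hmφ hb hg]

end Toric

theorem mainTheorem3 :
    (¬ ∃ Δ' : Toric.Fan Toric.stdLattice, Δ'.Refines Toric.fanP1xP1 ∧ Δ'.IsRegular ∧
      Δ'.AlgebraicallyStable (Toric.matrixMap !![0, -8; 1, 4])
        (Toric.matrixMap_mem_stdLattice !![0, -8; 1, 4])) ∧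
    ∃ N' : Submodule ℤ Toric.Plane, N' ≤ Toric.stdLattice ∧
      N'.toAddSubgroup.relIndex Toric.stdLattice.toAddSubgroup ≠ 0 ∧
      ∃ hN' : ∀ n ∈ N', Toric.matrixMap !![0, -8; 1, 4] n ∈ N',
      ∃ Δ' : Toric.Fan N', Δ'.Refines Toric.fanP1xP1 ∧ Δ'.IsRegular ∧
        Δ'.AlgebraicallyStable (Toric.matrixMap !![0, -8; 1, 4]) hN' := by
  exact ⟨Toric.not_exists_algebraicallyStable_refinement, Toric.coverLattice,
    Toric.coverLattice_le, Toric.relIndex_coverLattice, Toric.matrixMap_mem_coverLattice,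
    Toric.wallFan, Toric.wallFan_refines, Toric.wallFan_smooth.isRegular,
    Toric.wallFan_algebraicallyStable⟩
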